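/- Let $\mathbb K$ be $\mathbb R$ or $\mathbb C$ and let $1<p<\infty$. For a set $\Gamma$ and a function $w:\Gamma\to(0,\infty)$, let $\mu(A)=\sum_{\gamma\in A}w(\gamma)$ for $A\subseteq\Gamma$, and let $\ell^{p,\infty}(\Gamma,w)$ be the space of all functions $f:\Gamma\to\mathbb K$ with $$\|f\|=\sup_{c>0}c\,\bigl(\mu\{\gamma\in\Gamma:|f(\gamma)|>c\}\bigr)^{1/p}<\infty,$$ with the topology of the quasi-norm $\|\cdot\|$. Let $\ell^{p,\infty}$ denote the space $\ell^{p,\infty}(\mathbb N,1)$ (counting measure), let $\ell^\infty$ be the Banach space of bounded sequences in $\mathbb K$, and write $E\sim F$ if $E$ and $F$ are linearly homeomorphic. Let $\Gamma$ be a countably infinite set, let $w:\Gamma\to\{2^n:n\in\mathbb Z\}$ be any function, and put $\Gamma_n=\{\gamma\in\Gamma:w(\gamma)=2^n\}$ for $n\in\mathbb Z$. Then 1. $\ell^{p,\infty}(\Gamma,w)\sim\ell^{p,\infty}$ if and only if $\sup_{n\in\mathbb Z}|\Gamma_n|=\infty$; 2. $\ell^{p,\infty}(\Gamma,w)\sim\ell^\infty$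 if and only if $\sup_{n\in\mathbb Z}|\Gamma_n|<\infty$. -/

import Mathlib

open scoped ENNReal NNReal

noncomputable section

/-- The measure `μ(A) = ∑_{γ ∈ A} w(γ)` on the power set of `Γ`. -/
def weightMeasure {Γ : Type*} (w : Γ → ℝ) (A : Set Γ) : ℝ≥0∞ :=
  ∑' γ : A, ENNReal.ofReal (w γ)

/-- The weak `L^p` quasi-norm `sup_{c > 0} c (μ{|f| > c})^{1/p}`, with values in `[0, ∞]`. -/
def weakQuasiNorm {Γ 𝕜 : Type*} [RCLike 𝕜] (p : ℝ) (w : Γ → ℝ) (f : Γ → 𝕜) : ℝ≥0∞ :=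
  ⨆ (c : ℝ≥0) (_ : 0 < c), (c : ℝ≥0∞) * weightMeasure w {γ | c < ‖f γ‖₊} ^ (1 / p)

theorem weightMeasure_mono {Γ : Type*} (w : Γ → ℝ) {A B : Set Γ} (h : A ⊆ B) :
    weightMeasure w A ≤ weightMeasure w B :=
  ENNReal.tsum_mono_subtype (fun γ => ENNReal.ofReal (w γ)) h

theorem weightMeasure_union_le {Γ : Type*} (w : Γ → ℝ) (A B : Set Γ) :
    weightMeasure w (A ∪ B) ≤ weightMeasure w A + weightMeasure w B :=
  ENNReal.tsum_union_le (fun γ => ENNReal.ofReal (w γ)) A B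

theorem weakQuasiNorm_zero {Γ 𝕜 : Type*} [RCLike 𝕜] {p : ℝ} (hp : 1 < p) (w : Γ → ℝ) :
    weakQuasiNorm p w (0 : Γ → 𝕜) = 0 := by
  have hp' : 0 < p⁻¹ := by positivity
  simp [weakQuasiNorm, weightMeasure, hp']

theorem weakQuasiNorm_add_le {Γ 𝕜 : Type*} [RCLike 𝕜] {p : ℝ} (hp : 1 < p) (w : Γ → ℝ)
    (f g : Γ → 𝕜) :
    weakQuasiNorm p w (f + g) ≤ 2 * (weakQuasiNorm p w f + weakQuasiNorm p w g) := by
  have hp0 : 0 ≤ 1 / p := by positivity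
  have hp1 : 1 / p ≤ 1 := by
    rw [div_le_one (by linarith)]; exact hp.le
  refine iSup₂_le fun c hc => ?_
  have hc2 : 0 < c / 2 := by positivity
  have hsub : {γ | c < ‖(f + g) γ‖₊} ⊆ {γ | c / 2 < ‖f γ‖₊} ∪ {γ | c / 2 < ‖g γ‖₊} := by
    intro γ hγ
    by_contra hcon
    simp only [Set.mem_union, Set.mem_ofPred_eq, not_or, not_lt] at hcon
    have h1 : c < ‖f γ + g γ‖₊ := hγ
    have h2 := (nnnorm_add_le (f γ) (g γ)).trans (add_le_add hcon.1 hcon.2)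
    rw [add_halves] at h2
    exact absurd h1 (not_lt.mpr h2)
  have hcc : (c : ℝ≥0∞) = 2 * ((c / 2 : ℝ≥0) : ℝ≥0∞) := by
    have h : c = 2 * (c / 2) := by rw [mul_div_cancel₀]; exact two_ne_zero
    exact_mod_cast h
  have hf : ((c / 2 : ℝ≥0) : ℝ≥0∞) * weightMeasure w {γ | c / 2 < ‖f γ‖₊} ^ (1 / p)
      ≤ weakQuasiNorm p w f :=
    le_iSup₂ (f := fun (c : ℝ≥0) (_ : 0 < c) =>
      (c : ℝ≥0∞) * weightMeasure w {γ | c < ‖f γ‖₊} ^ (1 / p)) (c / 2) hc2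
  have hg : ((c / 2 : ℝ≥0) : ℝ≥0∞) * weightMeasure w {γ | c / 2 < ‖g γ‖₊} ^ (1 / p)
      ≤ weakQuasiNorm p w g :=
    le_iSup₂ (f := fun (c : ℝ≥0) (_ : 0 < c) =>
      (c : ℝ≥0∞) * weightMeasure w {γ | c < ‖g γ‖₊} ^ (1 / p)) (c / 2) hc2
  calc (c : ℝ≥0∞) * weightMeasure w {γ | c < ‖(f + g) γ‖₊} ^ (1 / p)
      ≤ c * (weightMeasure w {γ | c / 2 < ‖f γ‖₊}
          + weightMeasure w {γ | c / 2 < ‖g γ‖₊}) ^ (1 / p) := by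
        gcongr
        exact (weightMeasure_mono w hsub).trans (weightMeasure_union_le w _ _)
    _ ≤ c * (weightMeasure w {γ | c / 2 < ‖f γ‖₊} ^ (1 / p)
          + weightMeasure w {γ | c / 2 < ‖g γ‖₊} ^ (1 / p)) := by
        gcongr
        exact ENNReal.rpow_add_le_add_rpow _ _ hp0 hp1
    _ ≤ 2 * (weakQuasiNorm p w f + weakQuasiNorm p w g) := by
        rw [hcc, mul_assoc, mul_add]
        gcongr

theorem weakQuasiNorm_smul_le {Γ 𝕜 : Type*} [RCLike 𝕜] {p : ℝ} (hp : 1 < p) (w : Γ → ℝ)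
    (a : 𝕜) (f : Γ → 𝕜) :
    weakQuasiNorm p w (a • f) ≤ ‖a‖₊ * weakQuasiNorm p w f := by
  by_cases ha : a = 0
  · subst ha
    simp [weakQuasiNorm_zero hp]
  have ha' : 0 < ‖a‖₊ := by simpa [pos_iff_ne_zero] using ha
  refine iSup₂_le fun c hc => ?_
  have hset : {γ | c < ‖(a • f) γ‖₊} = {γ | c / ‖a‖₊ < ‖f γ‖₊} := by
    ext γ
    simp [div_lt_iff₀' ha', nnnorm_mul]
  have hcc : (c : ℝ≥0∞) = ‖a‖₊ * ((c / ‖a‖₊ : ℝ≥0) : ℝ≥0∞) := by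
    have h : c = ‖a‖₊ * (c / ‖a‖₊) := by rw [mul_div_cancel₀]; exact ha'.ne'
    exact_mod_cast h
  rw [hset, hcc, mul_assoc]
  gcongr
  exact le_iSup₂ (f := fun (c : ℝ≥0) (_ : 0 < c) =>
      (c : ℝ≥0∞) * weightMeasure w {γ | c < ‖f γ‖₊} ^ (1 / p)) (c / ‖a‖₊) (by positivity)

/-- The functions `f : Γ → 𝕜` with finite weak `L^p` quasi-norm. -/
def weakSubmodule (𝕜 : Type*) [RCLike 𝕜] {Γ : Type*} (p : ℝ) [hp : Fact (1 < p)] (w : Γ → ℝ) :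
    Submodule 𝕜 (Γ → 𝕜) where
  carrier := {f | weakQuasiNorm p w f < ∞}
  zero_mem' := by
    simp [weakQuasiNorm_zero hp.out]
  add_mem' := fun {f g} hf hg =>
    (weakQuasiNorm_add_le hp.out w f g).trans_lt
      (ENNReal.mul_lt_top (by simp) (ENNReal.add_lt_top.mpr ⟨hf, hg⟩))
  smul_mem' := fun a f hf =>
    (weakQuasiNorm_smul_le hp.out w a f).trans_lt (ENNReal.mul_lt_top (by simp) hf)

/-- The space `ℓ^{p,∞}(Γ, w)`. It is a type of its own, because its topology is the one of the
quasi-norm and not the topology of pointwise convergence. -/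
def WeakLp (𝕜 : Type*) [RCLike 𝕜] {Γ : Type*} (p : ℝ) [Fact (1 < p)] (w : Γ → ℝ) : Type _ :=
  ↥(weakSubmodule 𝕜 p w)

instance {𝕜 : Type*} [RCLike 𝕜] {Γ : Type*} (p : ℝ) [Fact (1 < p)] (w : Γ → ℝ) :
    AddCommGroup (WeakLp 𝕜 p w) :=
  inferInstanceAs (AddCommGroup ↥(weakSubmodule 𝕜 p w))

instance {𝕜 : Type*} [RCLike 𝕜] {Γ : Type*} (p : ℝ) [Fact (1 < p)] (w : Γ → ℝ) :
    Module 𝕜 (WeakLp 𝕜 p w) :=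
  inferInstanceAs (Module 𝕜 ↥(weakSubmodule 𝕜 p w))

/-- The quasi-norm of an element of `ℓ^{p,∞}(Γ, w)`. -/
def WeakLp.quasiNorm {𝕜 : Type*} [RCLike 𝕜] {Γ : Type*} {p : ℝ} [Fact (1 < p)] {w : Γ → ℝ}
    (f : WeakLp 𝕜 p w) : ℝ≥0∞ :=
  weakQuasiNorm p w f.1

/-- The topology of the quasi-norm: `U` is open if and only if it contains a quasi-norm ball
around each of its points. -/
instance {𝕜 : Type*} [RCLike 𝕜] {Γ : Type*} (p : ℝ) [Fact (1 < p)] (w : Γ → ℝ) :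
    TopologicalSpace (WeakLp 𝕜 p w) where
  IsOpen U := ∀ f ∈ U, ∃ ε : ℝ≥0∞, 0 < ε ∧ ∀ g : WeakLp 𝕜 p w, (g - f).quasiNorm < ε → g ∈ U
  isOpen_univ := fun _ _ => ⟨1, one_pos, fun _ _ => Set.mem_univ _⟩
  isOpen_inter := by
    rintro U V hU hV f ⟨hfU, hfV⟩
    obtain ⟨ε, hε, h⟩ := hU f hfU
    obtain ⟨δ, hδ, h'⟩ := hV f hfV
    exact ⟨min ε δ, lt_min hε hδ, fun g hg =>
      ⟨h g (hg.trans_le (min_le_left _ _)), h' g (hg.trans_le (min_le_right _ _))⟩⟩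
  isOpen_sUnion := by
    rintro S hS f ⟨U, hUS, hfU⟩
    obtain ⟨ε, hε, h⟩ := hS U hUS f hfU
    exact ⟨ε, hε, fun g hg => ⟨U, hUS, h g hg⟩⟩

end

/-! Kolmogorov's inequality (`sum_le_of_weak`) makes the quasi-norm equivalent to the norm sup_A
μ(A)^{1/p-1} ∑_A w|f| over finite sets A, so weak ℓ^p becomes a Banach space E
(`weakLpEquivMeanSpace`). This norm is lower semicontinuous under pointwise limits, so bounded
sequences in E have limits along an ultrafilter. Let Z be the space of bounded sequences in ℓ^{p,∞}.

E is always complemented in Z (`isComplementedIn_seq`): after scaling by 2^k, the atoms of weight at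
least 2^{-k} become blocks of unit atoms, and an ultralimit over k recovers the function. If the
multiplicities are unbounded, Z is complemented in E (`seq_isComplementedIn`): truncations of the
terms of a sequence are placed on levels whose weights are so far apart that they hardly interact,
and an ultralimit undoes the truncation. Pełczyński's method (`IsComplementedIn.equiv_seq`) then
gives E ~ Z. Counting measure is one such weight, whence E ~ ℓ^{p,∞}.

If the multiplicities are bounded, the measure of a set is comparable to its largest atom, and
multiplication by w^{1/p} is an isomorphism onto ℓ^∞ (`nonempty_equiv_linfty`).

The two alternatives exclude each other because the identity of ℓ^{p,∞} does not factor through ℓ^∞: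
Riesz products bound the trace of such a factorization on n unit vectors by a constant times
n^{1-1/(2p)}, while the trace is n (`natCast_le_of_leftInverse`). -/

open scoped BoundedContinuousFunction

noncomputable section

/-! ### The averaging norm -/

/-- `C` bounds all the averages `μ(A)^{1/p-1} ∑_{γ ∈ A} w(γ)|f(γ)|` over finite sets `A`. -/
def IsMeanBound {Γ 𝕜 : Type*} [RCLike 𝕜] (p : ℝ) (w : Γ → ℝ) (f : Γ → 𝕜) (C : ℝ) : Prop :=
  ∀ A : Finset Γ, ∑ γ ∈ A, w γ * ‖f γ‖ ≤ C * (∑ γ ∈ A, w γ) ^ (1 - 1 / p)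

section Basic

variable {𝕜 : Type*} [RCLike 𝕜] {Γ : Type*} {p : ℝ} {w : Γ → ℝ}

theorem one_div_mem_Ioo [hp : Fact (1 < p)] : 0 < 1 / p ∧ 1 / p < 1 := by
  have := hp.out
  exact ⟨by positivity, by rw [div_lt_one (by linarith)]; exact this⟩

theorem weight_sum_nonneg [hw : Fact (∀ γ, 0 < w γ)] (A : Finset Γ) : 0 ≤ ∑ γ ∈ A, w γ :=
  Finset.sum_nonneg fun γ _ => (hw.out γ).le

theorem IsMeanBound.add [hw : Fact (∀ γ, 0 < w γ)] {f g : Γ → 𝕜} {C D : ℝ}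
    (hf : IsMeanBound p w f C) (hg : IsMeanBound p w g D) : IsMeanBound p w (f + g) (C + D) := by
  intro A
  calc ∑ γ ∈ A, w γ * ‖(f + g) γ‖ ≤ ∑ γ ∈ A, (w γ * ‖f γ‖ + w γ * ‖g γ‖) := by
        refine Finset.sum_le_sum fun γ _ => ?_
        rw [← mul_add]
        exact mul_le_mul_of_nonneg_left (norm_add_le _ _) (hw.out γ).le
    _ ≤ _ := by
        rw [Finset.sum_add_distrib, add_mul]
        exact add_le_add (hf A) (hg A)

theorem IsMeanBound.smul {f : Γ → 𝕜} {C : ℝ} (a : 𝕜)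
    (hf : IsMeanBound p w f C) : IsMeanBound p w (a • f) (‖a‖ * C) := by
  intro A
  calc ∑ γ ∈ A, w γ * ‖(a • f) γ‖ = ‖a‖ * ∑ γ ∈ A, w γ * ‖f γ‖ := by
        rw [Finset.mul_sum]
        refine Finset.sum_congr rfl fun γ _ => ?_
        simp only [Pi.smul_apply, smul_eq_mul, norm_mul]
        ring
    _ ≤ _ := by
        rw [mul_assoc]
        exact mul_le_mul_of_nonneg_left (hf A) (norm_nonneg _)

theorem IsMeanBound.mono [Fact (∀ γ, 0 < w γ)] {f : Γ → 𝕜} {C D : ℝ}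
    (hf : IsMeanBound p w f C) (h : C ≤ D) : IsMeanBound p w f D := fun A =>
  (hf A).trans (mul_le_mul_of_nonneg_right h (Real.rpow_nonneg (weight_sum_nonneg A) _))

end Basic

/-- The functions with bounded averages. -/
def meanSubmodule (𝕜 : Type*) [RCLike 𝕜] {Γ : Type*} (p : ℝ) (w : Γ → ℝ)
    [Fact (∀ γ, 0 < w γ)] : Submodule 𝕜 (Γ → 𝕜) where
  carrier := {f | ∃ C, IsMeanBound p w f C}
  zero_mem' := ⟨0, fun A => by simp⟩
  add_mem' := fun ⟨_, hf⟩ ⟨_, hg⟩ => ⟨_, hf.add hg⟩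
  smul_mem' := fun a _ ⟨_, hf⟩ => ⟨_, hf.smul a⟩

/-- The space of functions with bounded averages, with the norm
`sup_A μ(A)^{1/p-1} ∑_{γ ∈ A} w(γ)|f(γ)|`. -/
def MeanSpace (𝕜 : Type*) [RCLike 𝕜] {Γ : Type*} (p : ℝ) (w : Γ → ℝ)
    [Fact (∀ γ, 0 < w γ)] : Type _ :=
  ↥(meanSubmodule 𝕜 p w)

namespace MeanSpace

variable {𝕜 : Type*} [RCLike 𝕜] {Γ : Type*} {p : ℝ} {w : Γ → ℝ} [hw : Fact (∀ γ, 0 < w γ)]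

instance : AddCommGroup (MeanSpace 𝕜 p w) := inferInstanceAs (AddCommGroup ↥(meanSubmodule 𝕜 p w))

instance : Module 𝕜 (MeanSpace 𝕜 p w) := inferInstanceAs (Module 𝕜 ↥(meanSubmodule 𝕜 p w))

instance : CoeFun (MeanSpace 𝕜 p w) fun _ => Γ → 𝕜 := ⟨fun f => f.1⟩

instance : Norm (MeanSpace 𝕜 p w) := ⟨fun f => sInf {C | 0 ≤ C ∧ IsMeanBound p w f.1 C}⟩

/-- The element given by a function with a bound for its averages. -/
def mk (f : Γ → 𝕜) (h : ∃ C, IsMeanBound p w f C) : MeanSpace 𝕜 p w := ⟨f, h⟩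

@[simp] theorem mk_apply (f : Γ → 𝕜) (h : ∃ C, IsMeanBound p w f C) (γ : Γ) : mk f h γ = f γ := rfl

@[simp] theorem add_apply (f g : MeanSpace 𝕜 p w) (γ : Γ) : (f + g) γ = f γ + g γ := rfl

@[simp] theorem zero_apply (γ : Γ) : (0 : MeanSpace 𝕜 p w) γ = 0 := rfl

@[simp] theorem smul_apply (a : 𝕜) (f : MeanSpace 𝕜 p w) (γ : Γ) : (a • f) γ = a * f γ := rfl

@[ext] theorem ext {f g : MeanSpace 𝕜 p w} (h : ∀ γ, f γ = g γ) : f = g :=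
  Subtype.ext (funext h)

theorem bound_nonempty (f : MeanSpace 𝕜 p w) : {C | 0 ≤ C ∧ IsMeanBound p w f.1 C}.Nonempty := by
  obtain ⟨C, hC⟩ := f.2
  exact ⟨max C 0, le_max_right _ _, hC.mono (le_max_left _ _)⟩

theorem bound_bddBelow (f : MeanSpace 𝕜 p w) : BddBelow {C | 0 ≤ C ∧ IsMeanBound p w f.1 C} :=
  ⟨0, fun _ h => h.1⟩

theorem norm_le {f : MeanSpace 𝕜 p w} {C : ℝ} (hC : 0 ≤ C) (h : IsMeanBound p w f.1 C) :
    ‖f‖ ≤ C :=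
  csInf_le f.bound_bddBelow ⟨hC, h⟩

theorem isMeanBound_norm (f : MeanSpace 𝕜 p w) : IsMeanBound p w f.1 ‖f‖ := by
  intro A
  have hm : 0 ≤ (∑ γ ∈ A, w γ) ^ (1 - 1 / p) := Real.rpow_nonneg (weight_sum_nonneg A) _
  -- When the power vanishes, as for empty `A` with p > 1, no division is possible; then any
  -- admissible constant already gives the claim.
  rcases hm.eq_or_lt with h0 | h0
  · obtain ⟨C, _, hC⟩ := f.bound_nonempty
    have := hC A
    rw [← h0] at this ⊢
    simpa using this
  · rw [← div_le_iff₀ h0]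
    refine le_csInf f.bound_nonempty fun C hC => ?_
    rw [div_le_iff₀ h0]
    exact hC.2 A

theorem core : NormedSpace.Core 𝕜 (MeanSpace 𝕜 p w) where
  norm_nonneg f := le_csInf f.bound_nonempty fun _ h => h.1
  norm_smul c f := by
    have h0 : ∀ g : MeanSpace 𝕜 p w, 0 ≤ ‖g‖ := fun g => le_csInf g.bound_nonempty fun _ h => h.1
    have key : ∀ (a : 𝕜) (g : MeanSpace 𝕜 p w), ‖a • g‖ ≤ ‖a‖ * ‖g‖ := fun a g =>
      norm_le (mul_nonneg (norm_nonneg _) (h0 g)) (g.isMeanBound_norm.smul a)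
    refine le_antisymm (key c f) ?_
    by_cases hc : c = 0
    · subst hc
      simpa using h0 _
    have hc' : 0 < ‖c‖ := norm_pos_iff.mpr hc
    have := key c⁻¹ (c • f)
    rw [smul_smul, inv_mul_cancel₀ hc, one_smul, norm_inv, inv_mul_eq_div, le_div_iff₀ hc'] at this
    linarith
  norm_triangle f g := by
    have h0 : ∀ g : MeanSpace 𝕜 p w, 0 ≤ ‖g‖ := fun g => le_csInf g.bound_nonempty fun _ h => h.1
    exact norm_le (add_nonneg (h0 f) (h0 g)) (f.isMeanBound_norm.add g.isMeanBound_norm)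
  norm_eq_zero_iff f := by
    constructor
    · intro h
      ext γ
      have := f.isMeanBound_norm {γ}
      rw [h] at this
      simp only [Finset.sum_singleton, zero_mul] at this
      have h2 := hw.out γ
      have h3 := norm_nonneg (f γ)
      have : ‖f γ‖ = 0 := le_antisymm (by nlinarith) h3
      simpa using this
    · rintro rfl
      exact le_antisymm (norm_le le_rfl fun A => by simp)
        (le_csInf (bound_nonempty _) fun _ h => h.1)

instance : NormedAddCommGroup (MeanSpace 𝕜 p w) := NormedAddCommGroup.ofCore core

instance : NormedSpace 𝕜 (MeanSpace 𝕜 p w) := NormedSpace.ofCore core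

theorem sum_le (f : MeanSpace 𝕜 p w) (A : Finset Γ) :
    ∑ γ ∈ A, w γ * ‖f γ‖ ≤ ‖f‖ * (∑ γ ∈ A, w γ) ^ (1 - 1 / p) := f.isMeanBound_norm A

/-- Evaluation at a point as a linear map. -/
def evalₗ (γ : Γ) : MeanSpace 𝕜 p w →ₗ[𝕜] 𝕜 where
  toFun f := f γ
  map_add' _ _ := rfl
  map_smul' _ _ := rfl

/-- A linear map into the functions with uniformly bounded averages, as an operator. -/
def lift {V : Type*} [SeminormedAddCommGroup V] [NormedSpace 𝕜 V] (L : V →ₗ[𝕜] (Γ → 𝕜)) (C : ℝ)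
    (h : ∀ v, IsMeanBound p w (L v) (C * ‖v‖)) : V →L[𝕜] MeanSpace 𝕜 p w :=
  LinearMap.mkContinuous
    { toFun := fun v => mk (L v) ⟨_, h v⟩
      map_add' := fun u v => by ext; simp
      map_smul' := fun a v => by ext; simp } |C|
    fun v => norm_le (by positivity)
      ((h v).mono (mul_le_mul_of_nonneg_right (le_abs_self C) (norm_nonneg v)))

theorem norm_lift_apply_le {V : Type*} [SeminormedAddCommGroup V] [NormedSpace 𝕜 V]
    (L : V →ₗ[𝕜] (Γ → 𝕜)) {C : ℝ} (hC : 0 ≤ C) (h : ∀ v, IsMeanBound p w (L v) (C * ‖v‖)) (v : V) :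
    ‖lift L C h v‖ ≤ C * ‖v‖ :=
  norm_le (by positivity) (h v)

theorem apply_le (f : MeanSpace 𝕜 p w) (γ : Γ) : ‖f γ‖ ≤ ‖f‖ * w γ ^ (-(1 / p)) := by
  have := f.sum_le {γ}
  have h := hw.out γ
  simp only [Finset.sum_singleton] at this
  rw [sub_eq_add_neg, Real.rpow_add h, Real.rpow_one] at this
  refine le_of_mul_le_mul_left ?_ h
  linarith

variable [hp : Fact (1 < p)]

/-- Chebyshev: with m the weight of `A`, c·m ≤ ∑ w|f| ≤ ‖f‖ m^{1-1/p}, hence c·m^{1/p} ≤ ‖f‖. The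
averaging norm thus dominates the weak one. -/
theorem rpow_mul_sum_le (f : MeanSpace 𝕜 p w) {c : ℝ} (hc : 0 ≤ c) (A : Finset Γ)
    (hA : ∀ γ ∈ A, c ≤ ‖f γ‖) : c ^ p * ∑ γ ∈ A, w γ ≤ ‖f‖ ^ p := by
  have hp0 : 0 < p := one_pos.trans hp.out
  rcases (weight_sum_nonneg (w := w) A).eq_or_lt with h0 | h0
  · rw [← h0, mul_zero]
    positivity
  set m := ∑ γ ∈ A, w γ
  have h1 : c * m ≤ ‖f‖ * m ^ (1 - 1 / p) := by
    refine le_trans ?_ (f.sum_le A)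
    rw [Finset.mul_sum]
    refine Finset.sum_le_sum fun γ hγ => ?_
    rw [mul_comm]
    exact mul_le_mul_of_nonneg_left (hA γ hγ) (hw.out γ).le
  have h2 : m ^ (1 - 1 / p) * m ^ (1 / p) = m := by
    rw [← Real.rpow_add h0]; simp
  have h3 : c * m ^ (1 / p) ≤ ‖f‖ := by
    have h4 : 0 < m ^ (1 - 1 / p) := Real.rpow_pos_of_pos h0 _
    refine le_of_mul_le_mul_right ?_ h4
    calc _ = c * (m ^ (1 - 1 / p) * m ^ (1 / p)) := by ring
      _ ≤ _ := by rw [h2]; exact h1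
  calc c ^ p * m = (c * m ^ (1 / p)) ^ p := by
        rw [Real.mul_rpow hc (by positivity), ← Real.rpow_mul h0.le, one_div_mul_cancel hp0.ne',
          Real.rpow_one]
    _ ≤ _ := Real.rpow_le_rpow (by positivity) h3 hp0.le

end MeanSpace

/-! ### Kolmogorov's inequality -/

section Kolmogorov

variable {p : ℝ} [hp : Fact (1 < p)]

/-- The constant of Kolmogorov's inequality. -/
def kolmogorovConst (p : ℝ) : ℝ := 2 / (1 - 2 ^ (1 - p))

theorem two_rpow_lt_one : (2 : ℝ) ^ (1 - p) < 1 :=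
  Real.rpow_lt_one_of_one_lt_of_neg one_lt_two (by linarith [hp.out])

theorem kolmogorovConst_pos : 0 < kolmogorovConst p :=
  div_pos two_pos (by linarith [two_rpow_lt_one (p := p)])

/-- **Kolmogorov's inequality**: a weak type bound bounds the averages. -/
theorem sum_le_of_weak {Γ : Type*} {w : Γ → ℝ} [hw : Fact (∀ γ, 0 < w γ)] {h : Γ → ℝ} {K : ℝ}
    (hK : 0 < K)
    (hweak : ∀ c > 0, ∀ A : Finset Γ, (∀ γ ∈ A, c ≤ h γ) → c ^ p * ∑ γ ∈ A, w γ ≤ K ^ p)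
    (A : Finset Γ) :
    ∑ γ ∈ A, w γ * h γ ≤ kolmogorovConst p * K * (∑ γ ∈ A, w γ) ^ (1 - 1 / p) := by
  classical
  have hp0 : 0 < p := one_pos.trans hp.out
  induction A using Finset.strongInduction with
  | H A ih =>
  rcases A.eq_empty_or_nonempty with rfl | hne
  · simp only [Finset.sum_empty]
    have := kolmogorovConst_pos (p := p)
    positivity
  set m := ∑ γ ∈ A, w γ with hm
  have hm0 : 0 < m := Finset.sum_pos (fun γ _ => hw.out γ) hne
  -- At this level the weak bound leaves `B` at most the fraction 2^{-p} of the weight of `A`, so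
  -- `B` is a proper subset and the induction applies to it; off `B` the trivial bound c·m is of the
  -- right order.
  set c := 2 * K * m ^ (-(1 / p)) with hc
  have hc0 : 0 < c := by positivity
  set B := A.filter fun γ => c ≤ h γ with hB
  have hBm : ∑ γ ∈ B, w γ ≤ 2 ^ (-p) * m := by
    have h1 := hweak c hc0 B fun γ hγ => (Finset.mem_filter.mp hγ).2
    have h2 : c ^ p = 2 ^ p * K ^ p * m⁻¹ := by
      rw [hc, Real.mul_rpow (by positivity) (by positivity), Real.mul_rpow (by positivity) hK.le,
        ← Real.rpow_mul hm0.le, neg_mul, one_div_mul_cancel hp0.ne', Real.rpow_neg_one]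
    have hKp : 0 < K ^ p := by positivity
    have h2p : 0 < (2 : ℝ) ^ p := by positivity
    rw [h2] at h1
    rw [Real.rpow_neg two_pos.le, inv_mul_eq_div, le_div_iff₀ h2p]
    have h3 : K ^ p * (2 ^ p * m⁻¹ * ∑ γ ∈ B, w γ) ≤ K ^ p * 1 := by linarith
    have h4 := le_of_mul_le_mul_left h3 hKp
    have h5 : 2 ^ p * m⁻¹ * ∑ γ ∈ B, w γ = ((∑ γ ∈ B, w γ) * 2 ^ p) / m := by
      field_simp
    rw [h5, div_le_one hm0] at h4
    exact h4
  have hlt : B ⊂ A := by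
    refine (Finset.filter_subset _ _).ssubset_of_ne fun hEq => ?_
    rw [hB, hEq, ← hm] at hBm
    have : (2 : ℝ) ^ (-p) < 1 := Real.rpow_lt_one_of_one_lt_of_neg one_lt_two (by linarith)
    nlinarith
  have hD := kolmogorovConst_pos (p := p)
  set D := kolmogorovConst p with hDdef
  have hIH := ih B hlt
  have hr : 0 ≤ 1 - 1 / p := by linarith [(one_div_mem_Ioo (p := p)).2]
  have h6 : (∑ γ ∈ B, w γ) ^ (1 - 1 / p) ≤ 2 ^ (1 - p) * m ^ (1 - 1 / p) := by
    calc (∑ γ ∈ B, w γ) ^ (1 - 1 / p) ≤ (2 ^ (-p) * m) ^ (1 - 1 / p) :=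
          Real.rpow_le_rpow (weight_sum_nonneg B) hBm hr
      _ = 2 ^ (1 - p) * m ^ (1 - 1 / p) := by
          rw [Real.mul_rpow (by positivity) hm0.le, ← Real.rpow_mul two_pos.le]
          congr 2
          field_simp
          ring
  have h7 : ∑ γ ∈ A.filter (fun γ => ¬ c ≤ h γ), w γ * h γ ≤ c * m := by
    calc ∑ γ ∈ A.filter (fun γ => ¬ c ≤ h γ), w γ * h γ
        ≤ ∑ γ ∈ A.filter (fun γ => ¬ c ≤ h γ), c * w γ := by
          refine Finset.sum_le_sum fun γ hγ => ?_
          rw [mul_comm c]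
          exact mul_le_mul_of_nonneg_left (not_le.mp (Finset.mem_filter.mp hγ).2).le (hw.out γ).le
      _ ≤ c * m := by
          rw [← Finset.mul_sum]
          exact mul_le_mul_of_nonneg_left (Finset.sum_le_sum_of_subset_of_nonneg
            (Finset.filter_subset _ _) fun γ _ _ => (hw.out γ).le) hc0.le
  have h8 : c * m = 2 * K * m ^ (1 - 1 / p) := by
    rw [hc, sub_eq_add_neg, Real.rpow_add hm0, Real.rpow_one]
    ring
  -- The recursion reproduces its own constant: `kolmogorovConst` is defined as this fixed point.
  have h9 : 2 + D * 2 ^ (1 - p) = D := by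
    have := two_rpow_lt_one (p := p)
    have h10 : (1 : ℝ) - 2 ^ (1 - p) ≠ 0 := by linarith
    rw [hDdef, kolmogorovConst]
    field_simp
    ring
  rw [← Finset.sum_filter_add_sum_filter_not A fun γ => c ≤ h γ]
  calc _ ≤ D * K * (2 ^ (1 - p) * m ^ (1 - 1 / p)) + 2 * K * m ^ (1 - 1 / p) := by
        rw [← h8]
        exact add_le_add (hIH.trans (mul_le_mul_of_nonneg_left h6 (by positivity))) h7
    _ = (2 + D * 2 ^ (1 - p)) * K * m ^ (1 - 1 / p) := by ring
    _ = _ := by rw [h9]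

/-- Adds the degenerate case K = 0, where the truncation level would be 0; there the weak bound on
singletons forces h ≤ 0. -/
theorem sum_le_of_weak' {Γ : Type*} {w : Γ → ℝ} [hw : Fact (∀ γ, 0 < w γ)] {h : Γ → ℝ} {K : ℝ}
    (hK : 0 ≤ K)
    (hweak : ∀ c > 0, ∀ A : Finset Γ, (∀ γ ∈ A, c ≤ h γ) → c ^ p * ∑ γ ∈ A, w γ ≤ K ^ p)
    (A : Finset Γ) :
    ∑ γ ∈ A, w γ * h γ ≤ kolmogorovConst p * K * (∑ γ ∈ A, w γ) ^ (1 - 1 / p) := by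
  have hp0 : 0 < p := one_pos.trans hp.out
  rcases hK.eq_or_lt with rfl | hK
  · have hle : ∀ γ, h γ ≤ 0 := by
      intro γ
      by_contra! hγ
      have := hweak (h γ) hγ {γ} (by simp)
      rw [Real.zero_rpow hp0.ne', Finset.sum_singleton] at this
      have h1 := hw.out γ
      have h2 : 0 < h γ ^ p := Real.rpow_pos_of_pos hγ _
      nlinarith
    rw [mul_zero, zero_mul]
    exact Finset.sum_nonpos fun γ _ => mul_nonpos_of_nonneg_of_nonpos (hw.out γ).le (hle γ)
  · exact sum_le_of_weak hK hweak A

theorem isMeanBound_of_weak {𝕜 : Type*} [RCLike 𝕜] {Γ : Type*} {w : Γ → ℝ}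
    [hw : Fact (∀ γ, 0 < w γ)] {f : Γ → 𝕜} {K : ℝ} (hK : 0 ≤ K)
    (hweak : ∀ c > 0, ∀ A : Finset Γ, (∀ γ ∈ A, c ≤ ‖f γ‖) → c ^ p * ∑ γ ∈ A, w γ ≤ K ^ p) :
    IsMeanBound p w f (kolmogorovConst p * K) :=
  fun A => sum_le_of_weak' hK hweak A

end Kolmogorov

/-! ### Equivalence of the quasi-norm and the averaging norm -/

section WeakEquiv

variable {𝕜 : Type*} [RCLike 𝕜] {Γ : Type*} {p : ℝ} [hp : Fact (1 < p)] {w : Γ → ℝ}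
  [hw : Fact (∀ γ, 0 < w γ)]

theorem ofReal_sum_le_weightMeasure {A : Finset Γ} {S : Set Γ} (h : ↑A ⊆ S) :
    ENNReal.ofReal (∑ γ ∈ A, w γ) ≤ weightMeasure w S := by
  refine le_trans (le_of_eq ?_) (weightMeasure_mono w h)
  rw [ENNReal.ofReal_sum_of_nonneg fun γ _ => (hw.out γ).le, weightMeasure]
  exact (Finset.tsum_subtype A fun γ => ENNReal.ofReal (w γ)).symm

theorem weightMeasure_le_of_forall_finset {S : Set Γ} {M : ℝ}
    (h : ∀ A : Finset Γ, ↑A ⊆ S → ∑ γ ∈ A, w γ ≤ M) : weightMeasure w S ≤ ENNReal.ofReal M := by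
  rw [weightMeasure, ENNReal.tsum_eq_iSup_sum]
  refine iSup_le fun B => ?_
  rw [← ENNReal.ofReal_sum_of_nonneg fun γ _ => (hw.out γ.1).le]
  refine ENNReal.ofReal_le_ofReal ?_
  have := h (B.map (Function.Embedding.subtype _)) (by
    intro γ
    simp only [Finset.coe_map, Set.mem_image]
    rintro ⟨x, _, rfl⟩
    exact x.2)
  simpa using this

theorem rpow_mul_sum_le_weakQuasiNorm {f : Γ → 𝕜} (hf : weakQuasiNorm p w f < ∞) {c : ℝ}
    (hc : 0 < c) (A : Finset Γ) (hA : ∀ γ ∈ A, c ≤ ‖f γ‖) :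
    c ^ p * ∑ γ ∈ A, w γ ≤ (2 * (weakQuasiNorm p w f).toReal) ^ p := by
  have hp0 : 0 < p := one_pos.trans hp.out
  set m := ∑ γ ∈ A, w γ
  have hm : 0 ≤ m := weight_sum_nonneg A
  -- The quasi-norm uses strict superlevel sets and `A` only satisfies c ≤ |f|; halving the level
  -- makes the inequality strict and costs the factor 2.
  set d : ℝ≥0 := ⟨c / 2, by positivity⟩
  have hd : 0 < d := by
    rw [← NNReal.coe_pos]
    change 0 < c / 2
    positivity
  have h1 : (d : ℝ≥0∞) * weightMeasure w {γ | d < ‖f γ‖₊} ^ (1 / p) ≤ weakQuasiNorm p w f :=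
    le_iSup₂ (f := fun (c : ℝ≥0) (_ : 0 < c) =>
      (c : ℝ≥0∞) * weightMeasure w {γ | c < ‖f γ‖₊} ^ (1 / p)) d hd
  have h2 : (↑A : Set Γ) ⊆ {γ | d < ‖f γ‖₊} := by
    intro γ hγ
    have := hA γ hγ
    change d < ‖f γ‖₊
    rw [← NNReal.coe_lt_coe]
    change c / 2 < ‖f γ‖
    linarith
  have h3 : ENNReal.ofReal (c / 2 * m ^ (1 / p)) ≤ weakQuasiNorm p w f := by
    refine le_trans ?_ h1
    rw [ENNReal.ofReal_mul (by positivity),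
      ← ENNReal.ofReal_rpow_of_nonneg hm (by positivity)]
    refine mul_le_mul' (le_of_eq ?_)
      (ENNReal.rpow_le_rpow (ofReal_sum_le_weightMeasure h2) (by positivity))
    rw [ENNReal.ofReal, Real.toNNReal_of_nonneg (by positivity)]
    rfl
  have h4 : c * m ^ (1 / p) ≤ 2 * (weakQuasiNorm p w f).toReal := by
    have := (ENNReal.ofReal_le_iff_le_toReal hf.ne).mp h3
    linarith
  calc c ^ p * m = (c * m ^ (1 / p)) ^ p := by
        rw [Real.mul_rpow hc.le (by positivity), ← Real.rpow_mul hm, one_div_mul_cancel hp0.ne',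
          Real.rpow_one]
    _ ≤ _ := Real.rpow_le_rpow (by positivity) h4 hp0.le

theorem weakQuasiNorm_le_norm (f : MeanSpace 𝕜 p w) :
    weakQuasiNorm p w f.1 ≤ ENNReal.ofReal ‖f‖ := by
  have hp0 : 0 < p := one_pos.trans hp.out
  refine iSup₂_le fun c hc => ?_
  have hc' : (0 : ℝ) < c := hc
  have h1 : weightMeasure w {γ | c < ‖f.1 γ‖₊} ≤ ENNReal.ofReal ((‖f‖ / c) ^ p) := by
    refine weightMeasure_le_of_forall_finset fun A hA => ?_
    rw [Real.div_rpow (norm_nonneg _) hc'.le, le_div_iff₀ (by positivity), mul_comm]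
    refine f.rpow_mul_sum_le hc'.le A fun γ hγ => ?_
    have : c < ‖f.1 γ‖₊ := hA hγ
    exact (NNReal.coe_lt_coe.mpr this).le
  calc (c : ℝ≥0∞) * weightMeasure w {γ | c < ‖f.1 γ‖₊} ^ (1 / p)
      ≤ c * ENNReal.ofReal ((‖f‖ / c) ^ p) ^ (1 / p) := by gcongr
    _ = ENNReal.ofReal ‖f‖ := by
      rw [ENNReal.ofReal_rpow_of_nonneg (by positivity) (by positivity),
        ← Real.rpow_mul (by positivity), mul_one_div_cancel hp0.ne', Real.rpow_one,
        ← ENNReal.ofReal_coe_nnreal, ← ENNReal.ofReal_mul hc'.le, mul_div_cancel₀ _ hc'.ne']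

theorem isMeanBound_weakQuasiNorm {f : Γ → 𝕜} (hf : weakQuasiNorm p w f < ∞) :
    IsMeanBound p w f (kolmogorovConst p * (2 * (weakQuasiNorm p w f).toReal)) :=
  isMeanBound_of_weak (by positivity) fun _ hc A hA => rpow_mul_sum_le_weakQuasiNorm hf hc A hA

/-- Weak `ℓ^p` with its quasi-norm is the Banach space of functions with bounded averages. -/
def weakLpEquivMeanSpace : WeakLp 𝕜 p w ≃L[𝕜] MeanSpace 𝕜 p w where
  toFun f := MeanSpace.mk f.1 ⟨_, isMeanBound_weakQuasiNorm f.2⟩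
  invFun f := ⟨f.1, (weakQuasiNorm_le_norm f).trans_lt ENNReal.ofReal_lt_top⟩
  map_add' _ _ := rfl
  map_smul' _ _ := rfl
  left_inv _ := rfl
  right_inv _ := rfl
  continuous_toFun := by
    refine continuous_def.mpr fun U hU f hf => ?_
    obtain ⟨ε, hε, h⟩ := Metric.isOpen_iff.mp hU _ hf
    have hD := kolmogorovConst_pos (p := p)
    refine ⟨ENNReal.ofReal (ε / (kolmogorovConst p * 2)), by simp; positivity, fun g hg => h ?_⟩
    rw [Metric.mem_ball, dist_eq_norm]
    have h1 : (g - f).quasiNorm.toReal < ε / (kolmogorovConst p * 2) := by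
      rw [ENNReal.lt_ofReal_iff_toReal_lt (hg.trans ENNReal.ofReal_lt_top).ne] at hg
      exact hg
    rw [lt_div_iff₀ (by positivity)] at h1
    have h2 := MeanSpace.norm_le (f := MeanSpace.mk (g - f).1 ⟨_, isMeanBound_weakQuasiNorm (g - f).2⟩)
      (by positivity) (isMeanBound_weakQuasiNorm (g - f).2)
    refine lt_of_le_of_lt h2 (lt_of_eq_of_lt ?_ h1)
    change kolmogorovConst p * (2 * (g - f).quasiNorm.toReal) = _
    ring
  continuous_invFun := by
    refine continuous_def.mpr fun U hU => Metric.isOpen_iff.mpr fun f hf => ?_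
    obtain ⟨ε, hε, h⟩ := hU _ hf
    -- The radius ε may be ∞; capping it at 1 gives a real radius.
    have hm : 0 < min ε 1 := lt_min hε one_pos
    have hm' : min ε 1 ≠ ∞ := ne_top_of_le_ne_top ENNReal.one_ne_top (min_le_right _ _)
    refine ⟨(min ε 1).toReal, ENNReal.toReal_pos hm.ne' hm', fun g hg => h _ ?_⟩
    rw [Metric.mem_ball, dist_eq_norm] at hg
    refine lt_of_le_of_lt (weakQuasiNorm_le_norm (g - f)) (lt_of_lt_of_le ?_ (min_le_left ε 1))
    exact (ENNReal.ofReal_lt_iff_lt_toReal (norm_nonneg _) hm').mpr hg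

end WeakEquiv

/-! ### Complemented subspaces and Pełczyński's decomposition -/

section BoundedSequences

variable {𝕜 : Type*} [RCLike 𝕜] {V W X Y : Type*} [NormedAddCommGroup V] [NormedSpace 𝕜 V]
  [NormedAddCommGroup W] [NormedSpace 𝕜 W] [NormedAddCommGroup X] [NormedSpace 𝕜 X]
  [NormedAddCommGroup Y] [NormedSpace 𝕜 Y]

/-- A uniformly bounded sequence of operators, as an operator into the bounded sequences. -/
def seqLift (T : ℕ → V →L[𝕜] W) (C : ℝ) (h : ∀ n v, ‖T n v‖ ≤ C * ‖v‖) : V →L[𝕜] (ℕ →ᵇ W) :=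
  LinearMap.mkContinuous
    { toFun := fun v => BoundedContinuousFunction.ofNormedAddCommGroupDiscrete
        (fun n => T n v) (C * ‖v‖) fun n => h n v
      map_add' := fun u v => by ext n; simp
      map_smul' := fun a v => by ext n; simp } |C|
    fun v => by
      refine (BoundedContinuousFunction.norm_le (by positivity)).mpr fun n => ?_
      exact (h n v).trans (mul_le_mul_of_nonneg_right (le_abs_self C) (norm_nonneg v))

@[simp] theorem seqLift_apply (T : ℕ → V →L[𝕜] W) (C : ℝ) (h : ∀ n v, ‖T n v‖ ≤ C * ‖v‖) (v : V)
    (n : ℕ) : seqLift T C h v n = T n v := rfl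

/-- `E` is (isomorphic to) a complemented subspace of `F`. -/
def IsComplementedIn (𝕜 E F : Type*) [RCLike 𝕜] [NormedAddCommGroup E] [NormedSpace 𝕜 E]
    [NormedAddCommGroup F] [NormedSpace 𝕜 F] : Prop :=
  ∃ (i : E →L[𝕜] F) (q : F →L[𝕜] E), ∀ x, q (i x) = x

theorem IsComplementedIn.trans (h : IsComplementedIn 𝕜 V W) (h' : IsComplementedIn 𝕜 W X) :
    IsComplementedIn 𝕜 V X := by
  obtain ⟨i, q, h⟩ := h
  obtain ⟨j, r, h'⟩ := h'
  exact ⟨j.comp i, q.comp r, fun x => by simp [h, h']⟩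

/-- The bounded sequences in `X` absorb complemented subspaces of `X`. -/
theorem IsComplementedIn.seq_equiv_prod (h : IsComplementedIn 𝕜 Y X) :
    Nonempty ((ℕ →ᵇ X) ≃L[𝕜] Y × (ℕ →ᵇ X)) := by
  obtain ⟨i, q, hiq⟩ := h
  let P : X →L[𝕜] X := i.comp q
  have hP : ∀ x, P (P x) = P x := fun x => by simp [P, hiq]
  have hqP : ∀ x, q (P x) = q x := fun x => by simp [P, hiq]
  have hPi : ∀ y, P (i y) = i y := fun y => by simp [P, hiq]
  let ev : ℕ → (ℕ →ᵇ X) →L[𝕜] X := fun n => BoundedContinuousFunction.evalCLM 𝕜 n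
  have hev : ∀ n (x : ℕ →ᵇ X), ‖ev n x‖ ≤ ‖x‖ := fun n x => x.norm_coe_le_norm n
  have hPb : ∀ x, ‖P x‖ ≤ ‖P‖ * ‖x‖ := P.le_opNorm
  -- X splits as ker P plus a copy of Y. Kernel components stay in place and the P-components shift
  -- left by one; the component that falls out at index 0 is the Y-coordinate of `F`.
  let A : ℕ → (ℕ →ᵇ X) →L[𝕜] X := fun n => ev n - P.comp (ev n) + P.comp (ev (n + 1))
  have hA : ∀ n x, ‖A n x‖ ≤ (1 + ‖P‖ + ‖P‖) * ‖x‖ := by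
    intro n x
    have h1 := hev n x
    have h2 := (hPb (ev n x)).trans (mul_le_mul_of_nonneg_left h1 (norm_nonneg _))
    have h3 := (hPb (ev (n + 1) x)).trans
      (mul_le_mul_of_nonneg_left (hev (n + 1) x) (norm_nonneg _))
    calc ‖ev n x - P (ev n x) + P (ev (n + 1) x)‖
        ≤ ‖ev n x‖ + ‖P (ev n x)‖ + ‖P (ev (n + 1) x)‖ :=
          (norm_add_le _ _).trans (add_le_add_left (norm_sub_le _ _) _)
      _ ≤ _ := by linarith
  let F : (ℕ →ᵇ X) →L[𝕜] Y × (ℕ →ᵇ X) := (q.comp (ev 0)).prod (seqLift A _ hA)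
  let fs := ContinuousLinearMap.fst 𝕜 Y (ℕ →ᵇ X)
  let sn := ContinuousLinearMap.snd 𝕜 Y (ℕ →ᵇ X)
  -- The inverse right shift, which inserts the Y-coordinate at index 0.
  let B : ℕ → Y × (ℕ →ᵇ X) →L[𝕜] X := fun n => n.casesOn
    ((ev 0).comp sn - P.comp ((ev 0).comp sn) + i.comp fs)
    (fun n => (ev (n + 1)).comp sn - P.comp ((ev (n + 1)).comp sn) + P.comp ((ev n).comp sn))
  have hB : ∀ n z, ‖B n z‖ ≤ (1 + ‖P‖ + (‖P‖ + ‖i‖)) * ‖z‖ := by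
    intro n z
    have hz1 : ‖z.1‖ ≤ ‖z‖ := norm_fst_le z
    have hz2 : ‖z.2‖ ≤ ‖z‖ := norm_snd_le z
    have e1 := fun n => (hev n z.2).trans hz2
    have e2 := fun n => (hPb (ev n z.2)).trans (mul_le_mul_of_nonneg_left (e1 n) (norm_nonneg _))
    have e3 := (i.le_opNorm z.1).trans (mul_le_mul_of_nonneg_left hz1 (norm_nonneg _))
    have n1 : 0 ≤ ‖P‖ * ‖z‖ := by positivity
    have n2 : 0 ≤ ‖i‖ * ‖z‖ := by positivity
    rcases n with _ | n
    · calc ‖ev 0 z.2 - P (ev 0 z.2) + i z.1‖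
          ≤ ‖ev 0 z.2‖ + ‖P (ev 0 z.2)‖ + ‖i z.1‖ :=
            (norm_add_le _ _).trans (add_le_add_left (norm_sub_le _ _) _)
        _ ≤ _ := by linarith [e1 0, e2 0]
    · calc ‖ev (n + 1) z.2 - P (ev (n + 1) z.2) + P (ev n z.2)‖
          ≤ ‖ev (n + 1) z.2‖ + ‖P (ev (n + 1) z.2)‖ + ‖P (ev n z.2)‖ :=
            (norm_add_le _ _).trans (add_le_add_left (norm_sub_le _ _) _)
        _ ≤ _ := by linarith [e1 (n + 1), e2 (n + 1), e2 n]
  let G : Y × (ℕ →ᵇ X) →L[𝕜] (ℕ →ᵇ X) := seqLift B _ hB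
  refine ⟨ContinuousLinearEquiv.equivOfInverse F G (fun x => ?_) fun z => ?_⟩
  · ext n
    have hF1 : (F x).1 = q (x 0) := rfl
    have hF2 : ∀ n, (F x).2 n = x n - P (x n) + P (x (n + 1)) := fun n => rfl
    rcases n with _ | n
    · change (F x).2 0 - P ((F x).2 0) + i (F x).1 = x 0
      rw [hF1, hF2]
      change _ + P (x 0) = x 0
      simp only [map_add, map_sub, hP]
      abel
    · change (F x).2 (n + 1) - P ((F x).2 (n + 1)) + P ((F x).2 n) = x (n + 1)
      rw [hF2, hF2]
      simp only [map_add, map_sub, hP]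
      abel
  · have hG0 : G z 0 = z.2 0 - P (z.2 0) + i z.1 := rfl
    have hGs : ∀ n, G z (n + 1) = z.2 (n + 1) - P (z.2 (n + 1)) + P (z.2 n) := fun n => rfl
    have hPG0 : P (G z 0) = i z.1 := by
      rw [hG0]; simp only [map_add, map_sub, hP, hPi]; abel
    have hPGs : ∀ n, P (G z (n + 1)) = P (z.2 n) := fun n => by
      rw [hGs]; simp only [map_add, map_sub, hP]; abel
    refine Prod.ext ?_ ?_
    · change q (G z 0) = z.1
      rw [← hqP, hPG0, hiq]
    · ext n
      change G z n - P (G z n) + P (G z (n + 1)) = z.2 n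
      rw [hPGs]
      rcases n with _ | n
      · rw [hPG0, hG0]; abel
      · rw [hPGs, hGs]; abel

/-- A space absorbs a complemented subspace that is isomorphic to its square. -/
theorem IsComplementedIn.equiv_prod (h : IsComplementedIn 𝕜 X Y) (s : X ≃L[𝕜] X × X) :
    Nonempty (Y ≃L[𝕜] X × Y) := by
  obtain ⟨j, r, hjr⟩ := h
  let sL : X →L[𝕜] X × X := s
  let sR : X × X →L[𝕜] X := s.symm
  let fs := ContinuousLinearMap.fst 𝕜 X X
  let sn := ContinuousLinearMap.snd 𝕜 X X
  -- Y is a copy of X plus ker r. The isomorphism `s` splits the X-part in two; one half is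
  -- released, the other is put back beside the untouched kernel part.
  let F : Y →L[𝕜] X × Y := (fs.comp (sL.comp r)).prod
    (j.comp (sn.comp (sL.comp r)) + (ContinuousLinearMap.id 𝕜 Y - j.comp r))
  let fs' := ContinuousLinearMap.fst 𝕜 X Y
  let sn' := ContinuousLinearMap.snd 𝕜 X Y
  let G : X × Y →L[𝕜] Y := j.comp (sR.comp (fs'.prod (r.comp sn'))) +
    (sn' - j.comp (r.comp sn'))
  refine ⟨ContinuousLinearEquiv.equivOfInverse F G (fun y => ?_) fun z => ?_⟩
  · change j (s.symm ((s (r y)).1, r (j (s (r y)).2 + (y - j (r y))))) +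
      (j (s (r y)).2 + (y - j (r y)) - j (r (j (s (r y)).2 + (y - j (r y))))) = y
    simp [hjr]
  · have hr : r (G z) = s.symm (z.1, r z.2) := by
      change r (j (s.symm (z.1, r z.2)) + (z.2 - j (r z.2))) = _
      simp [hjr]
    refine Prod.ext ?_ ?_
    · change (s (r (G z))).1 = z.1
      simp [hr]
    · change j (s (r (G z))).2 + (G z - j (r (G z))) = z.2
      rw [hr]
      change j (s (s.symm (z.1, r z.2))).2 +
        (j (s.symm (z.1, r z.2)) + (z.2 - j (r z.2)) - j (s.symm (z.1, r z.2))) = z.2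
      simp

/-- Bounded double sequences, enumerated. -/
def seqSeqEquiv : (ℕ →ᵇ X) ≃L[𝕜] (ℕ →ᵇ (ℕ →ᵇ X)) :=
  ContinuousLinearEquiv.equivOfInverse
    (seqLift (fun n => seqLift (fun m => BoundedContinuousFunction.evalCLM 𝕜 (Nat.pair n m)) 1
        fun m x => by rw [one_mul]; exact x.norm_coe_le_norm _) 1 fun n x => by
      rw [one_mul]
      exact (BoundedContinuousFunction.norm_le (norm_nonneg x)).mpr fun m => x.norm_coe_le_norm _)
    (seqLift (fun k => (BoundedContinuousFunction.evalCLM 𝕜 k.unpair.2).comp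
        (BoundedContinuousFunction.evalCLM 𝕜 k.unpair.1)) 1 fun k x => by
      rw [one_mul]
      exact ((x k.unpair.1).norm_coe_le_norm _).trans (x.norm_coe_le_norm _))
    (fun x => by ext k; simp) (fun x => by ext n m; simp)

/-- **Pełczyński's decomposition method**. -/
theorem IsComplementedIn.equiv_seq (h : IsComplementedIn 𝕜 Y (ℕ →ᵇ X))
    (h' : IsComplementedIn 𝕜 (ℕ →ᵇ X) Y) : Nonempty (Y ≃L[𝕜] (ℕ →ᵇ X)) := by
  let e : (ℕ →ᵇ X) ≃L[𝕜] (ℕ →ᵇ (ℕ →ᵇ X)) := seqSeqEquiv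
  -- For Z = (ℕ →ᵇ X), the chain is Y ≅ Z × Y ≅ Y × ℓ^∞(Z) ≅ ℓ^∞(Z) ≅ Z. The first step needs Z ≅ Z
  -- × Z, which `e` and `b` provide.
  obtain ⟨a⟩ := h.seq_equiv_prod
  have hid : IsComplementedIn 𝕜 (ℕ →ᵇ X) (ℕ →ᵇ X) :=
    ⟨ContinuousLinearMap.id 𝕜 _, ContinuousLinearMap.id 𝕜 _, fun _ => rfl⟩
  obtain ⟨b⟩ := hid.seq_equiv_prod
  obtain ⟨c⟩ := h'.equiv_prod
    ((e.trans b).trans ((ContinuousLinearEquiv.refl 𝕜 _).prodCongr e.symm))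
  exact ⟨((c.trans (ContinuousLinearEquiv.prodComm 𝕜 _ _)).trans
    ((ContinuousLinearEquiv.refl 𝕜 Y).prodCongr e)).trans (a.symm.trans e.symm)⟩

end BoundedSequences

/-! ### Ultrafilter limits and block averaging -/

namespace MeanSpace

open Filter Topology

section Limit

variable {𝕜 : Type*} [RCLike 𝕜] {Γ : Type*} {p : ℝ} {w : Γ → ℝ} [hw : Fact (∀ γ, 0 < w γ)]

/-- Each coordinate stays in a closed ball of 𝕜, which is compact. -/
theorem exists_tendsto_hyperfilter (x : ℕ →ᵇ MeanSpace 𝕜 p w) (γ : Γ) :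
    ∃ a : 𝕜, Tendsto (fun k => x k γ) (hyperfilter ℕ) (𝓝 a) := by
  have h : ∀ k, x k γ ∈ Metric.closedBall (0 : 𝕜) (‖x‖ * w γ ^ (-(1 / p))) := fun k => by
    rw [mem_closedBall_zero_iff]
    exact ((x k).apply_le γ).trans (mul_le_mul_of_nonneg_right (x.norm_coe_le_norm k)
      (Real.rpow_nonneg (hw.out γ).le _))
  obtain ⟨a, _, ha⟩ := (isCompact_closedBall (0 : 𝕜) _).ultrafilter_le_nhds
    ((hyperfilter ℕ).map fun k => x k γ) (by
      rw [le_principal_iff]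
      exact mem_map.mpr (Eventually.of_forall (f := (hyperfilter ℕ : Filter ℕ)) h))
  exact ⟨a, ha⟩

/-- The pointwise limit of a bounded sequence along a nonprincipal ultrafilter. -/
def ultraLimFun (x : ℕ →ᵇ MeanSpace 𝕜 p w) (γ : Γ) : 𝕜 :=
  (exists_tendsto_hyperfilter x γ).choose

theorem tendsto_ultraLimFun (x : ℕ →ᵇ MeanSpace 𝕜 p w) (γ : Γ) :
    Tendsto (fun k => x k γ) (hyperfilter ℕ) (𝓝 (ultraLimFun x γ)) :=
  (exists_tendsto_hyperfilter x γ).choose_spec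

theorem ultraLimFun_eq {x : ℕ →ᵇ MeanSpace 𝕜 p w} {γ : Γ} {a : 𝕜}
    (h : Tendsto (fun k => x k γ) (hyperfilter ℕ) (𝓝 a)) : ultraLimFun x γ = a :=
  tendsto_nhds_unique (tendsto_ultraLimFun x γ) h

/-- The bound tests finite sets only, so it survives pointwise limits. -/
theorem isMeanBound_ultraLimFun (x : ℕ →ᵇ MeanSpace 𝕜 p w) :
    IsMeanBound p w (ultraLimFun x) (1 * ‖x‖) := by
  intro A
  rw [one_mul]
  refine le_of_tendsto (f := fun k => ∑ γ ∈ A, w γ * ‖x k γ‖) (x := (hyperfilter ℕ : Filter ℕ))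
    (tendsto_finsetSum A fun γ _ => (tendsto_ultraLimFun x γ).norm.const_mul _)
    (Eventually.of_forall fun k => ((x k).sum_le A).trans ?_)
  exact mul_le_mul_of_nonneg_right (x.norm_coe_le_norm k)
    (Real.rpow_nonneg (weight_sum_nonneg A) _)

/-- The pointwise limit along a nonprincipal ultrafilter, as an operator. -/
def ultraLim : (ℕ →ᵇ MeanSpace 𝕜 p w) →L[𝕜] MeanSpace 𝕜 p w :=
  lift
    { toFun := ultraLimFun
      map_add' := fun x y => funext fun γ =>
        ultraLimFun_eq ((tendsto_ultraLimFun x γ).add (tendsto_ultraLimFun y γ))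
      map_smul' := fun a x => funext fun γ =>
        ultraLimFun_eq ((tendsto_ultraLimFun x γ).const_mul a) } 1
    isMeanBound_ultraLimFun

theorem ultraLim_apply_eq {x : ℕ →ᵇ MeanSpace 𝕜 p w} {γ : Γ} {a : 𝕜}
    (h : ∀ᶠ k in atTop, x k γ = a) : ultraLim x γ = a := by
  refine ultraLimFun_eq (tendsto_const_nhds.congr' ?_)
  have h1 : ∀ᶠ k in cofinite, x k γ = a := by rwa [Nat.cofinite_eq_atTop]
  filter_upwards [hyperfilter_le_cofinite h1] with k hk using hk.symm

theorem norm_ultraLim_le (x : ℕ →ᵇ MeanSpace 𝕜 p w) : ‖ultraLim x‖ ≤ ‖x‖ :=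
  (norm_lift_apply_le _ zero_le_one _ x).trans_eq (one_mul _)

end Limit

section Block

variable {𝕜 : Type*} [RCLike 𝕜] {Γ Δ : Type*} {p : ℝ}
  {w : Γ → ℝ} [hw : Fact (∀ γ, 0 < w γ)] {v : Δ → ℝ}

/-- Disjoint finite blocks `B γ` in `Δ` which are empty or have measure `l * w γ`. -/
structure IsBlockSystem (w : Γ → ℝ) (v : Δ → ℝ) (B : Γ → Finset Δ) (l : ℝ) : Prop where
  pos : 0 < l
  disjoint : Pairwise fun γ γ' => Disjoint (B γ) (B γ')
  eq_empty_or : ∀ γ, B γ = ∅ ∨ ∑ δ ∈ B γ, v δ = l * w γ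

variable {B : Γ → Finset Δ} {l : ℝ}

theorem IsBlockSystem.sum_le (h : IsBlockSystem w v B l) (γ : Γ) :
    ∑ δ ∈ B γ, v δ ≤ l * w γ := by
  rcases h.eq_empty_or γ with h0 | h0
  · rw [h0, Finset.sum_empty]
    exact mul_nonneg h.pos.le (hw.out γ).le
  · exact h0.le

theorem IsBlockSystem.sum_biUnion_le [DecidableEq Δ] (h : IsBlockSystem w v B l) (A : Finset Γ) :
    ∑ δ ∈ A.biUnion B, v δ ≤ l * ∑ γ ∈ A, w γ := by
  rw [Finset.sum_biUnion fun γ _ γ' _ hne => h.disjoint hne, Finset.mul_sum]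
  exact Finset.sum_le_sum fun γ _ => h.sum_le γ

open Classical in
/-- The function that is constant on the blocks. -/
def blockExtendₗ (p : ℝ) (B : Γ → Finset Δ) (l : ℝ) : MeanSpace 𝕜 p w →ₗ[𝕜] (Δ → 𝕜) where
  toFun f δ := if h : ∃ γ, δ ∈ B γ then ((l ^ (-(1 / p)) : ℝ) : 𝕜) * f h.choose else 0
  map_add' f g := by
    ext δ
    by_cases h : ∃ γ, δ ∈ B γ
    · simp [h, mul_add]
    · simp [h]
  map_smul' a f := by
    ext δ
    by_cases h : ∃ γ, δ ∈ B γ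
    · simp [h, mul_left_comm]
    · simp [h]

theorem blockExtendₗ_apply (h : IsBlockSystem w v B l) (f : MeanSpace 𝕜 p w) {γ : Γ} {δ : Δ}
    (hδ : δ ∈ B γ) : blockExtendₗ p B l f δ = ((l ^ (-(1 / p)) : ℝ) : 𝕜) * f γ := by
  have hex : ∃ γ, δ ∈ B γ := ⟨γ, hδ⟩
  have : hex.choose = γ := by
    by_contra hne
    exact Finset.disjoint_left.mp (h.disjoint hne) hex.choose_spec hδ
  simp [blockExtendₗ, hex, this]

variable [hp : Fact (1 < p)] [hv : Fact (∀ δ, 0 < v δ)]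

/-- A level set of the extension lies in the blocks over a level set of `f`. Its measure grows by at
most the factor l, which the normalization l^{-1/p} compensates. -/
theorem isMeanBound_blockExtendₗ (h : IsBlockSystem w v B l) (f : MeanSpace 𝕜 p w) :
    IsMeanBound p v (blockExtendₗ p B l f) (kolmogorovConst p * ‖f‖) := by
  classical
  have hp0 : 0 < p := one_pos.trans hp.out
  have hl := h.pos
  refine isMeanBound_of_weak (norm_nonneg f) fun c hc A hA => ?_
  rcases A.eq_empty_or_nonempty with rfl | ⟨δ₀, hδ₀⟩
  · rw [Finset.sum_empty, mul_zero]
    positivity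
  have hown : ∀ δ ∈ A, ∃ γ, δ ∈ B γ := by
    intro δ hδ
    by_contra hcon
    have := hA δ hδ
    simp only [blockExtendₗ, LinearMap.coe_mk, AddHom.coe_mk, dif_neg hcon, norm_zero] at this
    linarith
  have : Nonempty Γ := (hown δ₀ hδ₀).nonempty
  choose! o ho using hown
  have hG : ∀ γ ∈ A.image o, c * l ^ (1 / p) ≤ ‖f γ‖ := by
    intro γ hγ
    obtain ⟨δ, hδ, rfl⟩ := Finset.mem_image.mp hγ
    have := hA δ hδ
    rw [blockExtendₗ_apply h f (ho δ hδ), norm_mul, RCLike.norm_ofReal,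
      abs_of_pos (by positivity), Real.rpow_neg hl.le, inv_mul_eq_div,
      le_div_iff₀ (by positivity)] at this
    exact this
  have h1 := f.rpow_mul_sum_le (by positivity) _ hG
  rw [Real.mul_rpow hc.le (by positivity), ← Real.rpow_mul hl.le, one_div_mul_cancel hp0.ne',
    Real.rpow_one, mul_assoc] at h1
  refine le_trans ?_ h1
  refine mul_le_mul_of_nonneg_left (le_trans ?_ (h.sum_biUnion_le _)) (by positivity)
  refine Finset.sum_le_sum_of_subset_of_nonneg (fun δ hδ => ?_) fun δ _ _ => (hv.out δ).le
  exact Finset.mem_biUnion.mpr ⟨o δ, Finset.mem_image_of_mem _ hδ, ho δ hδ⟩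

/-- The embedding onto the functions that are constant on the blocks. -/
def blockExtend (h : IsBlockSystem w v B l) : MeanSpace 𝕜 p w →L[𝕜] MeanSpace 𝕜 p v :=
  lift (blockExtendₗ p B l) (kolmogorovConst p) (isMeanBound_blockExtendₗ h)

theorem blockExtend_apply (h : IsBlockSystem w v B l) (f : MeanSpace 𝕜 p w) {γ : Γ} {δ : Δ}
    (hδ : δ ∈ B γ) : blockExtend h f δ = ((l ^ (-(1 / p)) : ℝ) : 𝕜) * f γ :=
  blockExtendₗ_apply h f hδ

theorem norm_blockExtend_le (h : IsBlockSystem w v B l) (f : MeanSpace 𝕜 p w) :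
    ‖(blockExtend h f : MeanSpace 𝕜 p v)‖ ≤ kolmogorovConst p * ‖f‖ :=
  norm_lift_apply_le _ kolmogorovConst_pos.le _ f

/-- The averages over the blocks. -/
def blockAverageₗ (w : Γ → ℝ) (B : Γ → Finset Δ) (l : ℝ) : MeanSpace 𝕜 p v →ₗ[𝕜] (Γ → 𝕜) where
  toFun g γ := ((l ^ (1 / p) / (l * w γ) : ℝ) : 𝕜) * ∑ δ ∈ B γ, (v δ : 𝕜) * g δ
  map_add' f g := by
    ext γ
    simp [mul_add, Finset.sum_add_distrib]
  map_smul' a f := by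
    ext γ
    simp only [smul_apply, RingHom.id_apply, Pi.smul_apply, smul_eq_mul, Finset.mul_sum]
    exact Finset.sum_congr rfl fun δ _ => by ring

/-- The sum over `A` is dominated by a sum of w|g|-type over the union of the blocks, of measure at
most l·μ(A); the powers of l cancel, so the norm is at most 1 whatever l is. -/
theorem isMeanBound_blockAverageₗ (h : IsBlockSystem w v B l) (g : MeanSpace 𝕜 p v) :
    IsMeanBound p w (blockAverageₗ w B l g) (1 * ‖g‖) := by
  classical
  intro A
  have hl := h.pos
  have hr : 0 ≤ 1 - 1 / p := by linarith [(one_div_mem_Ioo (p := p)).2]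
  have h1 : ∀ γ, w γ * ‖blockAverageₗ w B l g γ‖ ≤
      l ^ (1 / p) / l * ∑ δ ∈ B γ, v δ * ‖g δ‖ := by
    intro γ
    have hwγ := hw.out γ
    simp only [blockAverageₗ, LinearMap.coe_mk, AddHom.coe_mk, norm_mul, RCLike.norm_ofReal]
    rw [abs_of_pos (by positivity)]
    have h2 : ‖∑ δ ∈ B γ, (v δ : 𝕜) * g δ‖ ≤ ∑ δ ∈ B γ, v δ * ‖g δ‖ := by
      refine (norm_sum_le _ _).trans (le_of_eq (Finset.sum_congr rfl fun δ _ => ?_))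
      rw [norm_mul, RCLike.norm_ofReal, abs_of_pos (hv.out δ)]
    calc _ = l ^ (1 / p) / l * ‖∑ δ ∈ B γ, (v δ : 𝕜) * g δ‖ := by field_simp
      _ ≤ _ := mul_le_mul_of_nonneg_left h2 (by positivity)
  calc ∑ γ ∈ A, w γ * ‖blockAverageₗ w B l g γ‖
      ≤ l ^ (1 / p) / l * ∑ δ ∈ A.biUnion B, v δ * ‖g δ‖ := by
        rw [Finset.sum_biUnion fun γ _ γ' _ hne => h.disjoint hne, Finset.mul_sum]
        exact Finset.sum_le_sum fun γ _ => h1 γ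
    _ ≤ l ^ (1 / p) / l * (‖g‖ * (l * ∑ γ ∈ A, w γ) ^ (1 - 1 / p)) := by
        refine mul_le_mul_of_nonneg_left ((g.sum_le _).trans ?_) (by positivity)
        exact mul_le_mul_of_nonneg_left (Real.rpow_le_rpow (weight_sum_nonneg _)
          (h.sum_biUnion_le A) hr) (norm_nonneg _)
    _ = 1 * ‖g‖ * (∑ γ ∈ A, w γ) ^ (1 - 1 / p) := by
        rw [Real.mul_rpow hl.le (weight_sum_nonneg A), Real.rpow_sub hl, Real.rpow_one]
        field_simp

/-- The operator of averaging over the blocks. -/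
def blockAverage (h : IsBlockSystem w v B l) : MeanSpace 𝕜 p v →L[𝕜] MeanSpace 𝕜 p w :=
  lift (blockAverageₗ w B l) 1 (isMeanBound_blockAverageₗ h)

theorem blockAverage_apply (h : IsBlockSystem w v B l) (g : MeanSpace 𝕜 p v) (γ : Γ) :
    blockAverage h g γ =
      ((l ^ (1 / p) / (l * w γ) : ℝ) : 𝕜) * ∑ δ ∈ B γ, (v δ : 𝕜) * g δ := rfl

theorem norm_blockAverage_le (h : IsBlockSystem w v B l) (g : MeanSpace 𝕜 p v) :
    ‖(blockAverage h g : MeanSpace 𝕜 p w)‖ ≤ 1 * ‖g‖ :=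
  norm_lift_apply_le _ zero_le_one _ g

theorem blockAverage_blockExtend (h : IsBlockSystem w v B l) (f : MeanSpace 𝕜 p w) {γ : Γ}
    (hγ : B γ ≠ ∅) : blockAverage h (blockExtend h f : MeanSpace 𝕜 p v) γ = f γ := by
  have hl := h.pos
  have hwγ := hw.out γ
  rw [blockAverage_apply, Finset.sum_congr rfl fun δ hδ => by rw [blockExtend_apply h f hδ],
    ← Finset.sum_mul, ← RCLike.ofReal_sum, (h.eq_empty_or γ).resolve_left hγ, ← mul_assoc,
    ← mul_assoc, ← RCLike.ofReal_mul, ← RCLike.ofReal_mul]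
  have : l ^ (1 / p) / (l * w γ) * (l * w γ) * l ^ (-(1 / p)) = 1 := by
    rw [Real.rpow_neg hl.le]
    field_simp
  rw [this, RCLike.ofReal_one, one_mul]

theorem IsBlockSystem.isComplementedIn (h : IsBlockSystem w v B l) (hB : ∀ γ, B γ ≠ ∅) :
    IsComplementedIn 𝕜 (MeanSpace 𝕜 p w) (MeanSpace 𝕜 p v) :=
  ⟨blockExtend h, blockAverage h, fun f => ext fun γ => blockAverage_blockExtend h f (hB γ)⟩

end Block

end MeanSpace

instance fact_one_pos : Fact (∀ γ : ℕ, 0 < (fun _ : ℕ => (1 : ℝ)) γ) := ⟨fun _ => one_pos⟩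

/-- Weak `ℓ^p` over `ℕ` with the counting measure, normed. -/
abbrev CountingSpace (𝕜 : Type*) [RCLike 𝕜] (p : ℝ) : Type _ :=
  MeanSpace 𝕜 p (fun _ : ℕ => (1 : ℝ))

open MeanSpace Filter

/-! ### Embedding into bounded sequences in ℓ^{p,∞} -/

section IntoSequences

variable {𝕜 : Type*} [RCLike 𝕜] {Γ : Type*} {w : Γ → ℝ}

/-- Disjoint blocks of natural numbers with prescribed sizes. -/
def natBlock (c s : Γ → ℕ) (γ : Γ) : Finset ℕ := (Finset.range (s γ)).image (Nat.pair (c γ))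

theorem sum_natBlock (c s : Γ → ℕ) (γ : Γ) : ∑ _i ∈ natBlock c s γ, (1 : ℝ) = s γ := by
  have : Function.Injective (Nat.pair (c γ)) := fun a b h => (Nat.pair_eq_pair.mp h).2
  simp [natBlock, Finset.card_image_of_injective _ this]

theorem isBlockSystem_natBlock {c s : Γ → ℕ} (hc : Function.Injective c) {l : ℝ} (hl : 0 < l)
    (hs : ∀ γ, s γ = 0 ∨ (s γ : ℝ) = l * w γ) :
    IsBlockSystem w (fun _ : ℕ => (1 : ℝ)) (natBlock c s) l where
  pos := hl
  disjoint γ γ' hne := by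
    refine Finset.disjoint_left.mpr fun i hi hi' => hne ?_
    obtain ⟨a, _, rfl⟩ := Finset.mem_image.mp hi
    obtain ⟨b, _, hb⟩ := Finset.mem_image.mp hi'
    exact hc (Nat.pair_eq_pair.mp hb).1.symm
  eq_empty_or γ := by
    rw [sum_natBlock]
    refine (hs γ).imp_left fun h => ?_
    simp [natBlock, h]

theorem natBlock_ne_empty (c : Γ → ℕ) {s : Γ → ℕ} {γ : Γ} (h : s γ ≠ 0) : natBlock c s γ ≠ ∅ := by
  simpa [natBlock, Finset.image_eq_empty] using h

variable {p : ℝ} [hp : Fact (1 < p)] [hw : Fact (∀ γ, 0 < w γ)] [Countable Γ]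

/-- Integral weights need no scaling: an atom of weight 2^a becomes 2^a unit atoms, and a single
block system suffices. -/
theorem isComplementedIn_countingSpace (a : Γ → ℕ) (ha : ∀ γ, w γ = 2 ^ a γ) :
    IsComplementedIn 𝕜 (MeanSpace 𝕜 p w) (CountingSpace 𝕜 p) := by
  obtain ⟨c, hc⟩ := exists_injective_nat Γ
  refine (isBlockSystem_natBlock (w := w) (s := fun γ => 2 ^ a γ) hc one_pos
    fun γ => Or.inr ?_).isComplementedIn fun γ => natBlock_ne_empty c (by positivity)
  simp [ha]

theorem isComplementedIn_seq (hw2 : ∀ γ, ∃ n : ℤ, w γ = (2 : ℝ) ^ n) :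
    IsComplementedIn 𝕜 (MeanSpace 𝕜 p w) (ℕ →ᵇ CountingSpace 𝕜 p) := by
  obtain ⟨c, hc⟩ := exists_injective_nat Γ
  choose n hn using hw2
  -- The k-th system scales by 2^k and drops the atoms lighter than 2^{-k}. Each atom is kept from
  -- some k on, and the operator bounds do not depend on k.
  let s : ℕ → Γ → ℕ := fun k γ => if 0 ≤ n γ + k then 2 ^ (n γ + k).toNat else 0
  have hs : ∀ k γ, s k γ = 0 ∨ (s k γ : ℝ) = 2 ^ k * w γ := by
    intro k γ
    by_cases h : 0 ≤ n γ + k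
    · right
      simp only [s, if_pos h, Nat.cast_pow, Nat.cast_ofNat, hn]
      rw [← zpow_natCast, Int.toNat_of_nonneg h, zpow_add₀ two_ne_zero, zpow_natCast, mul_comm]
    · left
      simp [s, h]
  have hB : ∀ k, IsBlockSystem w (fun _ : ℕ => (1 : ℝ)) (natBlock c (s k)) (2 ^ k) :=
    fun k => isBlockSystem_natBlock hc (by positivity) (hs k)
  let J : MeanSpace 𝕜 p w →L[𝕜] (ℕ →ᵇ CountingSpace 𝕜 p) :=
    seqLift (fun k => blockExtend (hB k)) (kolmogorovConst p) fun k f => norm_blockExtend_le (hB k) f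
  let Q : (ℕ →ᵇ CountingSpace 𝕜 p) →L[𝕜] (ℕ →ᵇ MeanSpace 𝕜 p w) :=
    seqLift (fun k => (blockAverage (hB k)).comp (BoundedContinuousFunction.evalCLM 𝕜 k)) 1
      fun k x => (norm_blockAverage_le (hB k) _).trans
        (mul_le_mul_of_nonneg_left (x.norm_coe_le_norm k) zero_le_one)
  refine ⟨J, ultraLim.comp Q, fun f => MeanSpace.ext fun γ => ultraLim_apply_eq ?_⟩
  filter_upwards [eventually_ge_atTop (n γ).natAbs] with k hk
  refine blockAverage_blockExtend (hB k) f (natBlock_ne_empty c ?_)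
  have h : 0 ≤ n γ + k := by omega
  simp [s, h]

end IntoSequences

/-! ### Bounded sequences inside E from a lacunary family of levels -/

section FromSequences

variable {𝕜 : Type*} [RCLike 𝕜] {Γ : Type*} {p : ℝ} {w : Γ → ℝ} [hw : Fact (∀ γ, 0 < w γ)]

/-- Injective, and the sum of the terms `m k * ω k` over the indices below `K` is at most `ω K`. -/
structure IsLacunary (m : ℕ → ℕ) (ω : ℕ → ℝ) : Prop where
  pos : ∀ k, 0 < ω k
  injective : Function.Injective ω
  sum_le : ∀ (F : Finset ℕ), ∀ K ∈ F, ∑ k ∈ F with ω k < ω K, m k * ω k ≤ ω K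

variable {m : ℕ → ℕ} {ω : ℕ → ℝ} {e : (Σ k, Fin (m k)) → Γ}

/-- Only the heaviest level present matters: its own term is at most s, and lacunarity bounds all
lighter ones together by its weight ω K ≤ s. -/
theorem IsLacunary.sum_mul_le (h : IsLacunary m ω) {F : Finset ℕ} {N : ℕ → ℕ} {s : ℝ} (hs : 0 ≤ s)
    (hN : ∀ k ∈ F, N k ≤ m k) (hω : ∀ k ∈ F, ω k ≤ s) (hNs : ∀ k ∈ F, ω k * N k ≤ s) :
    ∑ k ∈ F, ω k * N k ≤ 2 * s := by
  rcases F.eq_empty_or_nonempty with rfl | hne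
  · simpa using hs
  obtain ⟨K, hK, hmax⟩ := F.exists_max_image ω hne
  rw [← Finset.sum_filter_add_sum_filter_not F fun k => ω k < ω K]
  have h1 : F.filter (fun k => ¬ ω k < ω K) = {K} := by
    ext k
    simp only [Finset.mem_filter, not_lt, Finset.mem_singleton]
    constructor
    · rintro ⟨hk, hle⟩
      exact h.injective (le_antisymm (hmax k hk) hle)
    · rintro rfl
      exact ⟨hK, le_rfl⟩
  rw [h1, Finset.sum_singleton]
  have h2 : ∑ k ∈ F with ω k < ω K, ω k * N k ≤ ∑ k ∈ F with ω k < ω K, m k * ω k := by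
    refine Finset.sum_le_sum fun k hk => ?_
    rw [mul_comm]
    exact mul_le_mul_of_nonneg_right (by exact_mod_cast hN k (Finset.mem_filter.mp hk).1)
      (h.pos k).le
  have h3 := h.sum_le F K hK
  linarith [hω K hK, hNs K hK]

/-- Placing truncated copies of the terms of a sequence on a lacunary family of sets. -/
def spreadₗ (p : ℝ) (ω : ℕ → ℝ) (e : (Σ k, Fin (m k)) → Γ) (he : Function.Injective e) :
    (ℕ →ᵇ CountingSpace 𝕜 p) →ₗ[𝕜] (Γ → 𝕜) where
  toFun x := Function.extend e
    (fun a => ((ω a.1 ^ (-(1 / p)) : ℝ) : 𝕜) * x a.1.unpair.1 a.2) 0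
  map_add' x y := by
    ext γ
    by_cases h : ∃ a, e a = γ
    · obtain ⟨a, rfl⟩ := h
      simp [he.extend_apply, mul_add]
    · simp [Function.extend_apply' _ _ _ h]
  map_smul' c x := by
    ext γ
    by_cases h : ∃ a, e a = γ
    · obtain ⟨a, rfl⟩ := h
      simp [he.extend_apply, mul_left_comm]
    · simp [Function.extend_apply' _ _ _ h]

theorem spreadₗ_apply (he : Function.Injective e) (x : ℕ →ᵇ CountingSpace 𝕜 p)
    (a : Σ k, Fin (m k)) :
    spreadₗ p ω e he x (e a) = ((ω a.1 ^ (-(1 / p)) : ℝ) : 𝕜) * x a.1.unpair.1 a.2 := by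
  simp [spreadₗ, he.extend_apply]

variable [hp : Fact (1 < p)]

/-- Each level alone meets the superlevel set at height c in measure at most (‖x‖/c)^p, by Chebyshev
for one term of the sequence. Lacunarity turns this into twice that bound for all levels together.
-/
theorem isMeanBound_spreadₗ (h : IsLacunary m ω) (he : Function.Injective e)
    (hwe : ∀ a, w (e a) = ω a.1) (x : ℕ →ᵇ CountingSpace 𝕜 p) :
    IsMeanBound p w (spreadₗ p ω e he x) (2 * kolmogorovConst p * ‖x‖) := by
  classical
  have hp0 : 0 < p := one_pos.trans hp.out
  have hb : 2 * kolmogorovConst p * ‖x‖ = kolmogorovConst p * (2 * ‖x‖) := by ring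
  rw [hb]
  refine isMeanBound_of_weak (by positivity) fun c hc A hA => ?_
  have hcp : 0 < c ^ p := by positivity
  have hrange : ∀ γ ∈ A, γ ∈ Set.range e := by
    intro γ hγ
    by_contra hcon
    have := hA γ hγ
    have h0 : spreadₗ p ω e he x γ = 0 := by
      have hcon' : ¬ ∃ a, e a = γ := hcon
      simp [spreadₗ, Function.extend_apply' _ _ _ hcon']
    rw [h0, norm_zero] at this
    linarith
  set A' := A.preimage e he.injOn with hA'
  have hsum : ∑ γ ∈ A, w γ = ∑ a ∈ A', ω a.1 := by
    rw [Finset.sum_congr rfl fun a _ => (hwe a).symm]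
    exact (Finset.sum_preimage e A he.injOn w fun γ hγ hcon => absurd (hrange γ hγ) hcon).symm
  have hA'x : ∀ a ∈ A', c * ω a.1 ^ (1 / p) ≤ ‖x a.1.unpair.1 a.2‖ := by
    intro a ha
    have := hA (e a) (Finset.mem_preimage.mp ha)
    have hω := h.pos a.1
    rw [spreadₗ_apply, norm_mul, RCLike.norm_ofReal, abs_of_pos (by positivity),
      Real.rpow_neg hω.le, inv_mul_eq_div, le_div_iff₀ (by positivity)] at this
    exact this
  let fib : ℕ → Finset (Σ k, Fin (m k)) := fun k => A'.filter fun a => a.1 = k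
  have hfibinj : ∀ k, Set.InjOn (fun a : Σ k, Fin (m k) => (a.2 : ℕ)) (fib k) := by
    rintro k ⟨k₁, i⟩ hi ⟨k₂, j⟩ hj hij
    have e1 : k₁ = k := (Finset.mem_filter.mp hi).2
    have e2 : k₂ = k := (Finset.mem_filter.mp hj).2
    subst e1 e2
    have : i = j := Fin.ext hij
    rw [this]
  set s := ‖x‖ ^ p / c ^ p with hs
  have hfib : ∀ k, ω k * (fib k).card ≤ s := by
    intro k
    have hω := h.pos k
    have h1 := (x k.unpair.1).rpow_mul_sum_le (c := c * ω k ^ (1 / p)) (by positivity)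
      ((fib k).image fun a => (a.2 : ℕ)) (by
        intro i hi
        obtain ⟨a, ha, rfl⟩ := Finset.mem_image.mp hi
        have e1 : a.1 = k := (Finset.mem_filter.mp ha).2
        have := hA'x a (Finset.mem_filter.mp ha).1
        subst e1
        exact this)
    rw [Finset.sum_const, Finset.card_image_of_injOn (hfibinj k), nsmul_eq_mul, mul_one,
      Real.mul_rpow hc.le (by positivity), ← Real.rpow_mul hω.le, one_div_mul_cancel hp0.ne',
      Real.rpow_one] at h1
    rw [hs, le_div_iff₀ hcp]
    have h2 : ‖x k.unpair.1‖ ^ p ≤ ‖x‖ ^ p :=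
      Real.rpow_le_rpow (norm_nonneg _) (x.norm_coe_le_norm _) hp0.le
    linarith
  have hmain : ∑ γ ∈ A, w γ ≤ 2 * s := by
    rw [hsum, ← Finset.sum_fiberwise_of_maps_to (t := A'.image Sigma.fst)
      (g := Sigma.fst) fun a ha => Finset.mem_image_of_mem _ ha]
    have h3 : ∀ k, ∑ a ∈ A' with a.1 = k, ω a.1 = ω k * (fib k).card := by
      intro k
      rw [Finset.sum_congr rfl fun a ha => by rw [(Finset.mem_filter.mp ha).2], Finset.sum_const,
        nsmul_eq_mul, mul_comm]
    rw [Finset.sum_congr rfl fun k _ => h3 k]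
    refine h.sum_mul_le (by positivity) (fun k _ => ?_) (fun k hk => ?_) fun k _ => hfib k
    · rw [← Finset.card_range (m k)]
      refine Finset.card_le_card_of_injOn _ (fun a ha => ?_) (hfibinj k)
      have e1 : a.1 = k := (Finset.mem_filter.mp ha).2
      rw [← e1]
      simp
    -- A level that occurs contains at least one atom, so its ω k is at most s.
    · obtain ⟨a, ha, rfl⟩ := Finset.mem_image.mp hk
      refine le_trans ?_ (hfib a.1)
      have : 0 < (fib a.1).card := Finset.card_pos.mpr ⟨a, Finset.mem_filter.mpr ⟨ha, rfl⟩⟩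
      exact le_mul_of_one_le_right (h.pos _).le (by exact_mod_cast this)
  calc c ^ p * ∑ γ ∈ A, w γ ≤ c ^ p * (2 * s) := mul_le_mul_of_nonneg_left hmain hcp.le
    _ = 2 * ‖x‖ ^ p := by rw [hs]; field_simp
    _ ≤ 2 ^ p * ‖x‖ ^ p := by
        refine mul_le_mul_of_nonneg_right ?_ (by positivity)
        exact Real.self_le_rpow_of_one_le one_le_two hp.out.le
    _ = (2 * ‖x‖) ^ p := (Real.mul_rpow two_pos.le (norm_nonneg _)).symm

/-- The bounded sequences are complemented as soon as there is a lacunary family of sets. -/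
theorem IsLacunary.isComplementedIn (h : IsLacunary (fun k => k.unpair.2) ω)
    {e : (Σ k : ℕ, Fin k.unpair.2) → Γ} (he : Function.Injective e)
    (hwe : ∀ a, w (e a) = ω a.1) :
    IsComplementedIn 𝕜 (ℕ →ᵇ CountingSpace 𝕜 p) (MeanSpace 𝕜 p w) := by
  classical
  -- The index k codes a pair (n, m): level k carries the first m coordinates of the n-th term. For
  -- fixed n, the ultralimit over m restores the whole term.
  let B : ℕ → ℕ → Finset Γ := fun k i => if hi : i < k.unpair.2 then {e ⟨k, ⟨i, hi⟩⟩} else ∅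
  have hB : ∀ k, IsBlockSystem (fun _ : ℕ => (1 : ℝ)) w (B k) (ω k) := by
    refine fun k => ⟨h.pos k, fun i j hij => ?_, fun i => ?_⟩
    · by_cases hi : i < k.unpair.2
      · by_cases hj : j < k.unpair.2
        · simp only [B, dif_pos hi, dif_pos hj, Finset.disjoint_singleton]
          intro heq
          have := he heq
          simp only [Sigma.mk.injEq, heq_eq_eq, Fin.mk.injEq, true_and] at this
          exact hij this
        · simp [B, hj]
      · simp [B, hi]
    · by_cases hi : i < k.unpair.2
      · right
        simp [B, dif_pos hi, hwe]
      · left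
        simp [B, hi]
  let T : (ℕ →ᵇ CountingSpace 𝕜 p) →L[𝕜] MeanSpace 𝕜 p w :=
    lift (spreadₗ p ω e he) _ (isMeanBound_spreadₗ h he hwe)
  let Q : ℕ → MeanSpace 𝕜 p w →L[𝕜] (ℕ →ᵇ CountingSpace 𝕜 p) := fun n =>
    seqLift (fun m => blockAverage (hB (Nat.pair n m))) 1 fun m g => norm_blockAverage_le _ g
  have hQ : ∀ n g, ‖Q n g‖ ≤ 1 * ‖g‖ := fun n g =>
    (BoundedContinuousFunction.norm_le (by positivity)).mpr fun m => norm_blockAverage_le _ g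
  let R : MeanSpace 𝕜 p w →L[𝕜] (ℕ →ᵇ CountingSpace 𝕜 p) :=
    seqLift (fun n => ultraLim.comp (Q n)) 1 fun n g => (norm_ultraLim_le _).trans (hQ n g)
  refine ⟨T, R, fun x => BoundedContinuousFunction.ext fun n => MeanSpace.ext fun i =>
    ultraLim_apply_eq ?_⟩
  filter_upwards [eventually_gt_atTop i] with m hm
  change blockAverage (hB (Nat.pair n m)) (T x) i = x n i
  have hi : i < (Nat.pair n m).unpair.2 := by simpa using hm
  have hω := h.pos (Nat.pair n m)
  rw [blockAverage_apply]
  simp only [B, dif_pos hi, Finset.sum_singleton]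
  have hT : T x (e ⟨Nat.pair n m, ⟨i, hi⟩⟩) =
      ((ω (Nat.pair n m) ^ (-(1 / p)) : ℝ) : 𝕜) * x n i := by
    change spreadₗ p ω e he x _ = _
    rw [spreadₗ_apply]
    simp
  rw [hT, hwe, ← mul_assoc, ← mul_assoc, ← RCLike.ofReal_mul, ← RCLike.ofReal_mul]
  have : ω (Nat.pair n m) ^ (1 / p) / (ω (Nat.pair n m) * 1) * ω (Nat.pair n m) *
      ω (Nat.pair n m) ^ (-(1 / p)) = 1 := by
    rw [Real.rpow_neg hω.le]
    field_simp
  rw [this, RCLike.ofReal_one, one_mul]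

end FromSequences

/-! ### Finding lacunary families -/

section Lacunary

variable {m : ℕ → ℕ} {ω : ℕ → ℝ}

theorem isLacunary_of_le_succ (hpos : ∀ k, 0 < ω k) (h : ∀ k, (m k + 2) * ω k ≤ ω (k + 1)) :
    IsLacunary m ω := by
  have hmono : StrictMono ω := strictMono_nat_of_lt_succ fun k => by
    have h1 : 0 ≤ (m k : ℝ) * ω k := mul_nonneg (Nat.cast_nonneg _) (hpos k).le
    linarith [h k, hpos k]
  have hsum : ∀ K, ∑ k ∈ Finset.range K, m k * ω k ≤ ω K := by
    intro K
    induction K with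
    | zero => simpa using (hpos 0).le
    | succ K ih =>
      rw [Finset.sum_range_succ]
      linarith [h K, hpos K]
  refine ⟨hpos, hmono.injective, fun F K _ => le_trans ?_ (hsum K)⟩
  refine Finset.sum_le_sum_of_subset_of_nonneg (fun k hk => ?_) fun k _ _ =>
    mul_nonneg (Nat.cast_nonneg _) (hpos k).le
  exact Finset.mem_range.mpr (hmono.lt_iff_lt.mp (Finset.mem_filter.mp hk).2)

/-- The lighter levels now come after K, infinitely many of them; m (k+1) ω (k+1) ≤ ω k - ω (k+1)
makes their sum telescope. -/
theorem isLacunary_of_succ_le (hpos : ∀ k, 0 < ω k)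
    (h : ∀ k, (m (k + 1) + 2) * ω (k + 1) ≤ ω k) : IsLacunary m ω := by
  have hanti : StrictAnti ω := strictAnti_nat_of_succ_lt fun k => by
    have h1 : 0 ≤ (m (k + 1) : ℝ) * ω (k + 1) := mul_nonneg (Nat.cast_nonneg _) (hpos _).le
    linarith [h k, hpos (k + 1)]
  have hsum : ∀ K N, ∑ k ∈ Finset.Ioc K (K + N), m k * ω k ≤ ω K - ω (K + N) := by
    intro K N
    induction N with
    | zero => simp
    | succ N ih =>
      rw [← add_assoc, ← Finset.sum_Ioc_consecutive _ (Nat.le_add_right K N) (Nat.le_succ _)]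
      simp only [Nat.succ_eq_add_one, Nat.Ioc_succ_singleton, Finset.sum_singleton]
      linarith [h (K + N), hpos (K + N + 1)]
  refine ⟨hpos, hanti.injective, fun F K _ => ?_⟩
  refine le_trans ?_ ((hsum K (F.sup id)).trans (sub_le_self _ (hpos _).le))
  refine Finset.sum_le_sum_of_subset_of_nonneg (fun k hk => ?_) fun k _ _ =>
    mul_nonneg (Nat.cast_nonneg _) (hpos k).le
  obtain ⟨hkF, hlt⟩ := Finset.mem_filter.mp hk
  have h1 : k ≤ F.sup id := Finset.le_sup (f := id) hkF
  exact Finset.mem_Ioc.mpr ⟨hanti.lt_iff_gt.mp hlt, by omega⟩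

theorem add_two_mul_zpow_le {M : ℕ} {a b : ℤ} (h : a + M + 2 ≤ b) :
    ((M : ℝ) + 2) * 2 ^ a ≤ 2 ^ b := by
  have h1 : ((M : ℝ) + 2) ≤ 2 ^ (M + 2) := by
    have := (Nat.lt_two_pow_self (n := M + 2)).le
    exact_mod_cast this
  calc ((M : ℝ) + 2) * 2 ^ a ≤ 2 ^ (M + 2) * 2 ^ a :=
        mul_le_mul_of_nonneg_right h1 (by positivity)
    _ = 2 ^ (((M + 2 : ℕ) : ℤ) + a) := by rw [zpow_add₀ two_ne_zero, zpow_natCast]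
    _ ≤ 2 ^ b := zpow_le_zpow_right₀ one_le_two (by push_cast; linarith)

/-- The gap contains both m k and m (k+1), so the same sequence serves for increasing weights and,
after negation, for decreasing ones. -/
theorem exists_seq_gap {S : ℤ → ℕ∞} (h : ∀ (M : ℕ) (N : ℤ), ∃ n ≥ N, (M : ℕ∞) ≤ S n) (m : ℕ → ℕ) :
    ∃ n : ℕ → ℤ, ∀ k, (m k : ℕ∞) ≤ S (n k) ∧ n k + m k + m (k + 1) + 2 ≤ n (k + 1) := by
  choose f hf hS using h
  let n : ℕ → ℤ := fun k =>
    Nat.rec (f (m 0) 0) (fun k a => f (m (k + 1)) (a + m k + m (k + 1) + 2)) k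
  refine ⟨n, fun k => ⟨?_, hf _ _⟩⟩
  rcases k with _ | k
  · exact hS _ _
  · exact hS _ _

/-- Otherwise large values occur only in a bounded window of integers, where finitely many finite
values have a finite supremum. -/
theorem unbounded_right_or_left {S : ℤ → ℕ∞} (hS : ⨆ n, S n = ⊤) (hfin : ∀ n, S n ≠ ⊤) :
    (∀ (M : ℕ) (N : ℤ), ∃ n ≥ N, (M : ℕ∞) ≤ S n) ∨
      ∀ (M : ℕ) (N : ℤ), ∃ n ≥ N, (M : ℕ∞) ≤ S (-n) := by
  by_contra! hcon
  obtain ⟨⟨M, N, h⟩, M', N', h'⟩ := hcon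
  have hle : ⨆ n, S n ≤ max (max (M : ℕ∞) M') ((Finset.Ioo (-N') N).sup S) := by
    refine iSup_le fun n => ?_
    by_cases h1 : N ≤ n
    · exact (h n h1).le.trans ((le_max_left _ _).trans (le_max_left _ _))
    by_cases h2 : N' ≤ -n
    · have := h' (-n) h2
      rw [neg_neg] at this
      exact this.le.trans ((le_max_right _ _).trans (le_max_left _ _))
    · have hmem : n ∈ Finset.Ioo (-N') N := Finset.mem_Ioo.mpr ⟨by omega, by omega⟩
      exact (Finset.le_sup (f := S) hmem).trans (le_max_right _ _)
  rw [hS, top_le_iff] at hle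
  have hlt : max (max (M : ℕ∞) M') ((Finset.Ioo (-N') N).sup S) < ⊤ :=
    max_lt (max_lt (ENat.natCast_lt_top _) (ENat.natCast_lt_top _))
      ((Finset.sup_lt_iff (by simp)).mpr fun n _ => (hfin n).lt_top)
  exact hlt.ne hle

theorem exists_injective_fin_of_le_encard {Γ : Type*} {s : Set Γ} {k : ℕ}
    (h : (k : ℕ∞) ≤ s.encard) : ∃ f : Fin k → Γ, Function.Injective f ∧ ∀ i, f i ∈ s := by
  obtain ⟨t, hts, ht⟩ := Set.exists_subset_encard_eq h
  have hfin : t.Finite := Set.finite_of_encard_eq_coe ht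
  have hcard : hfin.toFinset.card = k := by
    have := hfin.encard_eq_coe_toFinset_card
    rw [ht] at this
    exact_mod_cast this.symm
  refine ⟨fun i => (hfin.toFinset.equivFinOfCardEq hcard).symm i,
    fun i j hij => (hfin.toFinset.equivFinOfCardEq hcard).symm.injective (Subtype.ext hij),
    fun i => hts ?_⟩
  exact hfin.mem_toFinset.mp ((hfin.toFinset.equivFinOfCardEq hcard).symm i).2

end Lacunary

/-! ### Unbounded multiplicities -/

section Unbounded

variable {𝕜 : Type*} [RCLike 𝕜] {Γ : Type*} {p : ℝ} {w : Γ → ℝ} [hw : Fact (∀ γ, 0 < w γ)]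
  [hp : Fact (1 < p)]

theorem IsLacunary.isComplementedIn_of_le_encard {n : ℕ → ℤ}
    (h : IsLacunary (fun k => k.unpair.2) fun k => (2 : ℝ) ^ n k)
    (hn : ∀ k : ℕ, (k.unpair.2 : ℕ∞) ≤ {γ : Γ | w γ = (2 : ℝ) ^ n k}.encard) :
    IsComplementedIn 𝕜 (ℕ →ᵇ CountingSpace 𝕜 p) (MeanSpace 𝕜 p w) := by
  choose f hf hfw using fun k => exists_injective_fin_of_le_encard (hn k)
  have hfw' : ∀ k i, w (f k i) = (2 : ℝ) ^ n k := hfw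
  refine h.isComplementedIn (e := fun a => f a.1 a.2) ?_ fun a => hfw _ _
  rintro ⟨k, i⟩ ⟨k', i'⟩ heq
  have hk : k = k' := h.injective ((hfw' k i).symm.trans ((congrArg w heq).trans (hfw' k' i')))
  subst hk
  exact congrArg (Sigma.mk k) (hf k heq)

/-- Passes through an auxiliary weight that is both lacunary and integral: 2^{k²} grows by the
factor 2^{2k+1}, which exceeds the multiplicity of level k by at least 2. -/
theorem seq_isComplementedIn_countingSpace :
    IsComplementedIn 𝕜 (ℕ →ᵇ CountingSpace 𝕜 p) (CountingSpace 𝕜 p) := by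
  let w' : (Σ k : ℕ, Fin k.unpair.2) → ℝ := fun a => 2 ^ (a.1 ^ 2)
  have : Fact (∀ a, 0 < w' a) := ⟨fun a => by positivity⟩
  have hlac : IsLacunary (fun k => k.unpair.2) fun k => (2 : ℝ) ^ (k ^ 2) := by
    refine isLacunary_of_le_succ (fun k => by positivity) fun k => ?_
    have h1 : k.unpair.2 + 2 ≤ 2 ^ (2 * k + 1) := by
      have h2 := Nat.unpair_right_le k
      have h3 : k + 1 < 2 ^ (k + 1) := Nat.lt_two_pow_self
      have h4 : 2 ^ (k + 1) ≤ 2 ^ (2 * k + 1) := Nat.pow_le_pow_right two_pos (by omega)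
      omega
    calc ((k.unpair.2 : ℝ) + 2) * 2 ^ (k ^ 2) ≤ 2 ^ (2 * k + 1) * 2 ^ (k ^ 2) :=
          mul_le_mul_of_nonneg_right (by exact_mod_cast h1) (by positivity)
      _ = 2 ^ ((k + 1) ^ 2) := by rw [← pow_add]; congr 1; ring
  exact (hlac.isComplementedIn (w := w') (e := id) Function.injective_id fun _ => rfl).trans
    (isComplementedIn_countingSpace (fun a => a.1 ^ 2) fun _ => rfl)

theorem countingSpace_isComplementedIn {n : ℤ} (h : {γ : Γ | w γ = (2 : ℝ) ^ n}.Infinite) :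
    IsComplementedIn 𝕜 (CountingSpace 𝕜 p) (MeanSpace 𝕜 p w) := by
  let f := h.natEmbedding
  have hB : IsBlockSystem (fun _ : ℕ => (1 : ℝ)) w (fun i => {(f i).1}) (2 ^ n) := by
    refine ⟨by positivity, fun i j hij => ?_, fun i => Or.inr ?_⟩
    · simp only [Finset.disjoint_singleton]
      exact fun heq => hij (f.injective (Subtype.ext heq))
    · rw [Finset.sum_singleton, mul_one]
      exact (f i).2
  exact hB.isComplementedIn fun i => Finset.singleton_ne_empty _

/-- An infinite level contains a copy of ℓ^{p,∞} itself. If all levels are finite, large ones occur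
at arbitrarily large or arbitrarily small weights, and a sparse selection is lacunary. -/
theorem seq_isComplementedIn (h : (⨆ n : ℤ, {γ : Γ | w γ = (2 : ℝ) ^ n}.encard) = ⊤) :
    IsComplementedIn 𝕜 (ℕ →ᵇ CountingSpace 𝕜 p) (MeanSpace 𝕜 p w) := by
  by_cases hinf : ∃ n : ℤ, {γ : Γ | w γ = (2 : ℝ) ^ n}.Infinite
  · obtain ⟨n, hn⟩ := hinf
    exact seq_isComplementedIn_countingSpace.trans (countingSpace_isComplementedIn hn)
  simp only [not_exists, Set.not_infinite] at hinf
  rcases unbounded_right_or_left h fun n => (hinf n).encard_lt_top.ne with h1 | h1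
  · obtain ⟨n, hn⟩ := exists_seq_gap h1 fun k => k.unpair.2
    refine IsLacunary.isComplementedIn_of_le_encard (n := n)
      (isLacunary_of_le_succ (fun k => by positivity) fun k => ?_) fun k => (hn k).1
    refine add_two_mul_zpow_le ?_
    have := (hn k).2
    omega
  · obtain ⟨n, hn⟩ := exists_seq_gap h1 fun k => k.unpair.2
    refine IsLacunary.isComplementedIn_of_le_encard (n := fun k => -n k)
      (isLacunary_of_succ_le (fun k => by positivity) fun k => ?_) fun k => (hn k).1
    refine add_two_mul_zpow_le ?_
    have := (hn k).2
    omega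

theorem nonempty_equiv_seq [Countable Γ] (hw2 : ∀ γ, ∃ n : ℤ, w γ = (2 : ℝ) ^ n)
    (h : (⨆ n : ℤ, {γ : Γ | w γ = (2 : ℝ) ^ n}.encard) = ⊤) :
    Nonempty (MeanSpace 𝕜 p w ≃L[𝕜] (ℕ →ᵇ CountingSpace 𝕜 p)) :=
  (isComplementedIn_seq hw2).equiv_seq (seq_isComplementedIn h)

theorem nonempty_equiv_countingSpace [Countable Γ] (hw2 : ∀ γ, ∃ n : ℤ, w γ = (2 : ℝ) ^ n)
    (h : (⨆ n : ℤ, {γ : Γ | w γ = (2 : ℝ) ^ n}.encard) = ⊤) :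
    Nonempty (MeanSpace 𝕜 p w ≃L[𝕜] CountingSpace 𝕜 p) := by
  obtain ⟨a⟩ := nonempty_equiv_seq (𝕜 := 𝕜) (p := p) hw2 h
  obtain ⟨b⟩ := (isComplementedIn_seq (𝕜 := 𝕜) (p := p) (w := fun _ : ℕ => (1 : ℝ))
    fun _ => ⟨0, by simp⟩).equiv_seq seq_isComplementedIn_countingSpace
  exact ⟨a.trans b.symm⟩

end Unbounded

/-! ### Riesz products -/

section RieszProduct

/-- The sign `±1` of a Boolean. -/
def boolSign (b : Bool) : ℝ := if b then 1 else -1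

theorem abs_boolSign (b : Bool) : |boolSign b| = 1 := by
  cases b <;> simp [boolSign]

/-- The imaginary part of a Riesz product. -/
def rieszProduct {n : ℕ} (y : Fin n → ℝ) (ε : Fin n → Bool) : ℝ :=
  (∏ k, (1 + ((boolSign (ε k) * y k : ℝ) : ℂ) * Complex.I)).im

/-- The sum over signs factorizes: summing the k-th factor over its sign gives 2 for k ≠ i, and the
extra sign turns the i-th factor into 2·y i·I. -/
theorem sum_boolSign_mul_rieszProduct {n : ℕ} (y : Fin n → ℝ) (i : Fin n) :
    ∑ ε : Fin n → Bool, boolSign (ε i) * rieszProduct y ε = 2 ^ n * y i := by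
  have h1 : ∑ ε : Fin n → Bool, ((boolSign (ε i) : ℝ) : ℂ) *
      ∏ k, (1 + ((boolSign (ε k) * y k : ℝ) : ℂ) * Complex.I) = ((2 ^ n * y i : ℝ) : ℂ) * Complex.I := by
    have h2 : ∀ ε : Fin n → Bool, ((boolSign (ε i) : ℝ) : ℂ) *
        ∏ k, (1 + ((boolSign (ε k) * y k : ℝ) : ℂ) * Complex.I) =
        ∏ k, ((if k = i then ((boolSign (ε k) : ℝ) : ℂ) else 1) *
          (1 + ((boolSign (ε k) * y k : ℝ) : ℂ) * Complex.I)) := by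
      intro ε
      rw [Finset.prod_mul_distrib, Finset.prod_ite_eq' Finset.univ i]
      simp
    have h3 : ∀ k, ∑ b : Bool, ((if k = i then ((boolSign b : ℝ) : ℂ) else 1) *
          (1 + ((boolSign b * y k : ℝ) : ℂ) * Complex.I)) =
        2 * (if k = i then (y k : ℂ) * Complex.I else 1) := by
      intro k
      rw [Fintype.sum_bool]
      by_cases hk : k = i
      · simp [hk, boolSign]; ring
      · simp [hk, boolSign]; ring
    rw [Finset.sum_congr rfl fun ε _ => h2 ε, ← Fintype.prod_sum (κ := fun _ => Bool)
      (fun k b => (if k = i then ((boolSign b : ℝ) : ℂ) else 1) *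
          (1 + ((boolSign b * y k : ℝ) : ℂ) * Complex.I)),
      Finset.prod_congr rfl fun k _ => h3 k, Finset.prod_mul_distrib,
      Finset.prod_ite_eq' Finset.univ i]
    simp
    ring
  have h4 := congrArg Complex.im h1
  simp only [Complex.im_sum, Complex.im_ofReal_mul, Complex.I_im, mul_one] at h4
  exact h4

/-- With imaginary increments, |1 ± iy|² = 1 + y² ≤ exp(y²), so the product is at most exp(1/2) ≤ 2.
-/
theorem abs_rieszProduct_le {n : ℕ} {y : Fin n → ℝ} (hy : ∑ k, y k ^ 2 ≤ 1) (ε : Fin n → Bool) :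
    |rieszProduct y ε| ≤ 2 := by
  have h1 : ∀ k, ‖1 + ((boolSign (ε k) * y k : ℝ) : ℂ) * Complex.I‖ ≤ Real.exp (y k ^ 2 / 2) := by
    intro k
    refine abs_le_of_sq_le_sq' ?_ (Real.exp_pos _).le |>.2
    rw [← Real.exp_nat_mul, ← Complex.normSq_eq_norm_sq, Complex.normSq_apply]
    have h2 := Real.add_one_le_exp (y k ^ 2)
    have h3 : (boolSign (ε k)) ^ 2 = 1 := by rw [← sq_abs, abs_boolSign, one_pow]
    have h4 : ((2 : ℕ) : ℝ) * (y k ^ 2 / 2) = y k ^ 2 := by push_cast; ring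
    rw [h4]
    simp only [Complex.add_re, Complex.one_re, Complex.mul_re, Complex.ofReal_re, Complex.I_re,
      Complex.ofReal_im, Complex.I_im, Complex.add_im, Complex.one_im, Complex.mul_im]
    nlinarith
  calc |rieszProduct y ε| ≤ ‖∏ k, (1 + ((boolSign (ε k) * y k : ℝ) : ℂ) * Complex.I)‖ :=
        Complex.abs_im_le_norm _
    _ ≤ ∏ k, Real.exp (y k ^ 2 / 2) := by
        rw [norm_prod]
        exact Finset.prod_le_prod (fun _ _ => norm_nonneg _) fun k _ => h1 k
    _ = Real.exp ((∑ k, y k ^ 2) / 2) := by rw [← Real.exp_sum, Finset.sum_div]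
    _ ≤ Real.exp (1 / 2) := Real.exp_le_exp.mpr (by linarith)
    _ ≤ 2 := by
        refine abs_le_of_sq_le_sq' ?_ two_pos.le |>.2
        rw [← Real.exp_nat_mul]
        have := Real.exp_one_lt_d9
        norm_num
        linarith

end RieszProduct

/-! ### Weak ℓ^p does not factor through ℓ^∞ -/

section NotIsomorphic

variable {𝕜 : Type*} [RCLike 𝕜] {p : ℝ}

/-- The element of `ℓ^∞` given by a bounded function. -/
def linftyMk (f : ℕ → 𝕜) (C : ℝ) (h : ∀ t, ‖f t‖ ≤ C) : lp (fun _ : ℕ => 𝕜) ∞ :=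
  ⟨f, memℓp_infty ⟨C, by rintro _ ⟨t, rfl⟩; exact h t⟩⟩

@[simp] theorem linftyMk_apply (f : ℕ → 𝕜) (C : ℝ) (h : ∀ t, ‖f t‖ ≤ C) (t : ℕ) :
    linftyMk f C h t = f t := rfl

theorem norm_linftyMk_le {f : ℕ → 𝕜} {C : ℝ} (hC : 0 ≤ C) (h : ∀ t, ‖f t‖ ≤ C) :
    ‖linftyMk f C h‖ ≤ C :=
  lp.norm_le_of_forall_le hC h

theorem linfty_apply_le (x : lp (fun _ : ℕ => 𝕜) ∞) (t : ℕ) : ‖x t‖ ≤ ‖x‖ :=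
  lp.norm_apply_le_norm ENNReal.top_ne_zero x t

theorem MeanSpace.sum_apply {Γ ι : Type*} {w : Γ → ℝ} [Fact (∀ γ, 0 < w γ)] (s : Finset ι)
    (f : ι → MeanSpace 𝕜 p w) (γ : Γ) : (∑ i ∈ s, f i) γ = ∑ i ∈ s, f i γ :=
  map_sum (evalₗ γ) f s

theorem sum_norm_le_countingSpace (g : CountingSpace 𝕜 p) (n : ℕ) :
    ∑ i : Fin n, ‖g i‖ ≤ ‖g‖ * (n : ℝ) ^ (1 - 1 / p) := by
  have := g.sum_le (Finset.range n)
  simpa [Finset.sum_range] using this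

/-- An operator from `ℓ^∞` to weak `ℓ^p` has small trace on systems with bounded square function. -/
theorem norm_trace_le (b : lp (fun _ : ℕ => 𝕜) ∞ →L[𝕜] CountingSpace 𝕜 p) {n : ℕ}
    (U : Fin n → lp (fun _ : ℕ => 𝕜) ∞) (u : Fin n → ℕ → ℝ) (hU : ∀ i t, U i t = (u i t : 𝕜))
    {l : ℝ} (hl : 0 < l) (hu : ∀ t, ∑ i, u i t ^ 2 ≤ l ^ 2) :
    ‖∑ i, b (U i) i‖ ≤ 2 * l * ‖b‖ * (n : ℝ) ^ (1 - 1 / p) := by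
  have hbound : ∀ (ε : Fin n → Bool) t,
      ‖((l * rieszProduct (fun k => u k t / l) ε : ℝ) : 𝕜)‖ ≤ 2 * l := by
    intro ε t
    rw [RCLike.norm_ofReal, abs_mul, abs_of_pos hl, mul_comm]
    refine mul_le_mul_of_nonneg_right (abs_rieszProduct_le ?_ ε) hl.le
    simp only [div_pow]
    rw [← Finset.sum_div, div_le_one (by positivity)]
    exact hu t
  -- Riesz products taken pointwise in t. They are bounded by 2l uniformly in the signs, and each `U
  -- i` is the average of ε i · F ε. The trace is thus an average of signed coordinate sums of b (F
  -- ε), each at most ‖b (F ε)‖ n^{1-1/p}.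
  let F : (Fin n → Bool) → lp (fun _ : ℕ => 𝕜) ∞ := fun ε => linftyMk _ _ (hbound ε)
  have hF : ∀ ε, ‖F ε‖ ≤ 2 * l := fun ε => norm_linftyMk_le (by positivity) _
  have hsum : ∀ i, ∑ ε, ((boolSign (ε i) : ℝ) : 𝕜) • F ε = ((2 ^ n : ℝ) : 𝕜) • U i := by
    intro i
    ext t
    have h1 := sum_boolSign_mul_rieszProduct (fun k => u k t / l) i
    rw [lp.coeFn_sum, Finset.sum_apply, lp.coeFn_smul, Pi.smul_apply, hU]
    simp only [lp.coeFn_smul, Pi.smul_apply, F, linftyMk_apply, smul_eq_mul]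
    rw [← RCLike.ofReal_mul]
    simp only [← RCLike.ofReal_mul]
    rw [← RCLike.ofReal_sum]
    congr 1
    calc _ = l * ∑ ε : Fin n → Bool, boolSign (ε i) * rieszProduct (fun k => u k t / l) ε := by
          rw [Finset.mul_sum]
          exact Finset.sum_congr rfl fun ε _ => by ring
      _ = _ := by
          rw [h1]
          field_simp
  have hb : ((2 ^ n : ℝ) : 𝕜) * ∑ i, b (U i) i =
      ∑ ε, ∑ i : Fin n, ((boolSign (ε i) : ℝ) : 𝕜) * b (F ε) i := by
    rw [Finset.sum_comm, Finset.mul_sum]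
    refine Finset.sum_congr rfl fun i _ => ?_
    have h2 := congrArg (fun z => b z i) (hsum i)
    simp only [map_sum, map_smul, MeanSpace.sum_apply, MeanSpace.smul_apply] at h2
    exact h2.symm
  have h3 : ∀ ε, ‖∑ i : Fin n, ((boolSign (ε i) : ℝ) : 𝕜) * b (F ε) i‖ ≤
      2 * l * ‖b‖ * (n : ℝ) ^ (1 - 1 / p) := by
    intro ε
    calc _ ≤ ∑ i : Fin n, ‖b (F ε) i‖ := by
          refine (norm_sum_le _ _).trans (le_of_eq (Finset.sum_congr rfl fun i _ => ?_))
          rw [norm_mul, RCLike.norm_ofReal, abs_boolSign, one_mul]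
      _ ≤ ‖b (F ε)‖ * (n : ℝ) ^ (1 - 1 / p) := sum_norm_le_countingSpace _ _
      _ ≤ _ := by
          refine mul_le_mul_of_nonneg_right ?_ (Real.rpow_nonneg (Nat.cast_nonneg _) _)
          calc ‖b (F ε)‖ ≤ ‖b‖ * ‖F ε‖ := b.le_opNorm _
            _ ≤ ‖b‖ * (2 * l) := mul_le_mul_of_nonneg_left (hF ε) (norm_nonneg _)
            _ = _ := by ring
  have h4 : (2 : ℝ) ^ n * ‖∑ i, b (U i) i‖ ≤ 2 ^ n * (2 * l * ‖b‖ * (n : ℝ) ^ (1 - 1 / p)) := by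
    calc (2 : ℝ) ^ n * ‖∑ i, b (U i) i‖ = ‖((2 ^ n : ℝ) : 𝕜) * ∑ i, b (U i) i‖ := by
          rw [norm_mul, RCLike.norm_ofReal, abs_of_pos (by positivity)]
      _ ≤ ∑ ε : Fin n → Bool, 2 * l * ‖b‖ * (n : ℝ) ^ (1 - 1 / p) := by
          rw [hb]
          exact (norm_sum_le _ _).trans (Finset.sum_le_sum fun ε _ => h3 ε)
      _ = _ := by simp
  exact le_of_mul_le_mul_left h4 (by positivity)

variable [hp : Fact (1 < p)]

theorem isMeanBound_of_support {f : ℕ → 𝕜} (S : Finset ℕ) (h1 : ∀ i, ‖f i‖ ≤ 1)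
    (h0 : ∀ i ∉ S, f i = 0) : IsMeanBound p (fun _ : ℕ => (1 : ℝ)) f ((S.card : ℝ) ^ (1 / p)) := by
  intro A
  obtain ⟨hq0, hq1⟩ := one_div_mem_Ioo (p := p)
  set j : ℝ := ((A.filter (· ∈ S)).card : ℝ) with hj
  have hj0 : 0 ≤ j := Nat.cast_nonneg _
  have hjS : j ≤ S.card := by
    rw [hj]
    exact_mod_cast Finset.card_le_card fun i hi => (Finset.mem_filter.mp hi).2
  have hjA : j ≤ ∑ _i ∈ A, (1 : ℝ) := by
    rw [hj, Finset.sum_const, nsmul_eq_mul, mul_one]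
    exact_mod_cast Finset.card_filter_le _ _
  calc ∑ i ∈ A, 1 * ‖f i‖ ≤ ∑ i ∈ A, if i ∈ S then (1 : ℝ) else 0 := by
        refine Finset.sum_le_sum fun i _ => ?_
        rw [one_mul]
        by_cases hi : i ∈ S
        · simpa [hi] using h1 i
        · simp [hi, h0 i hi]
    _ = j := by rw [hj, Finset.sum_boole]
    _ = j ^ (1 / p) * j ^ (1 - 1 / p) := by
        rw [← Real.rpow_add_of_nonneg hj0 hq0.le (by linarith)]
        simp
    _ ≤ _ := mul_le_mul (Real.rpow_le_rpow hj0 hjS hq0.le)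
        (Real.rpow_le_rpow hj0 hjA (by linarith)) (by positivity) (by positivity)

/-- Finitely supported functions with values in the unit ball. -/
def finiteVector (S : Finset ℕ) (f : ℕ → 𝕜) (h1 : ∀ i, ‖f i‖ ≤ 1) (h0 : ∀ i ∉ S, f i = 0) :
    CountingSpace 𝕜 p :=
  MeanSpace.mk f ⟨_, isMeanBound_of_support S h1 h0⟩

theorem norm_finiteVector_le (S : Finset ℕ) (f : ℕ → 𝕜) (h1 : ∀ i, ‖f i‖ ≤ 1)
    (h0 : ∀ i ∉ S, f i = 0) :
    ‖(finiteVector S f h1 h0 : CountingSpace 𝕜 p)‖ ≤ (S.card : ℝ) ^ (1 / p) :=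
  MeanSpace.norm_le (by positivity) (isMeanBound_of_support S h1 h0)

/-- The unit vectors. -/
def unitVector (𝕜 : Type*) [RCLike 𝕜] (p : ℝ) [Fact (1 < p)] (i : ℕ) : CountingSpace 𝕜 p :=
  finiteVector {i} (fun j => if j = i then 1 else 0) (fun j => by split_ifs <;> simp)
    fun j hj => by simpa using hj

theorem unitVector_apply (i j : ℕ) : unitVector 𝕜 p i j = if j = i then 1 else 0 := rfl

theorem norm_unitVector_le (i : ℕ) : ‖unitVector 𝕜 p i‖ ≤ 1 := by
  refine (norm_finiteVector_le _ _ _ _).trans ?_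
  simp

theorem norm_sum_smul_unitVector_le {n : ℕ} (s : Fin n → ℝ) (hs : ∀ i, |s i| ≤ 1) :
    ‖∑ i : Fin n, (s i : 𝕜) • unitVector 𝕜 p i‖ ≤ (n : ℝ) ^ (1 / p) := by
  let f : ℕ → 𝕜 := fun j => if h : j < n then (s ⟨j, h⟩ : 𝕜) else 0
  have h1 : ∀ j, ‖f j‖ ≤ 1 := by
    intro j
    by_cases h : j < n
    · simpa [f, h] using hs _
    · simp [f, h]
  have h0 : ∀ j ∉ Finset.range n, f j = 0 := by
    intro j hj
    simp only [Finset.mem_range] at hj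
    simp [f, hj]
  have h2 : ∑ i : Fin n, (s i : 𝕜) • unitVector 𝕜 p i = finiteVector (Finset.range n) f h1 h0 := by
    ext j
    rw [MeanSpace.sum_apply]
    simp only [MeanSpace.smul_apply, unitVector_apply]
    change _ = f j
    by_cases h : j < n
    · rw [Finset.sum_eq_single ⟨j, h⟩]
      · simp [f, h]
      · intro i _ hi
        have : j ≠ i := fun heq => hi (Fin.ext heq.symm)
        simp [this]
      · simp
    · simp only [f, dif_neg h]
      refine Finset.sum_eq_zero fun i _ => ?_
      have : j ≠ i := fun heq => h (heq ▸ i.2)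
      simp [this]
  rw [h2]
  refine (norm_finiteVector_le _ _ _ _).trans ?_
  simp

/-- The square function of the images of the unit vectors under an operator into `ℓ^∞`. -/
theorem sum_sq_le (a : CountingSpace 𝕜 p →L[𝕜] lp (fun _ : ℕ => 𝕜) ∞) (ρ : 𝕜 →ₗ[ℝ] ℝ)
    (hρ : ∀ z, |ρ z| ≤ ‖z‖) (n t : ℕ) :
    ∑ i : Fin n, ρ (a (unitVector 𝕜 p i) t) ^ 2 ≤ ‖a‖ ^ 2 * (n : ℝ) ^ (1 / p) := by
  set u : Fin n → ℝ := fun i => ρ (a (unitVector 𝕜 p i) t) with hu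
  have h1 : ∀ i, |u i| ≤ ‖a‖ := fun i => by
    refine (hρ _).trans ((linfty_apply_le _ t).trans ((a.le_opNorm _).trans ?_))
    exact mul_le_of_le_one_right (norm_nonneg _) (norm_unitVector_le _)
  -- Testing `a` on the sign combination bounds the ℓ¹ norm of u by ‖a‖ n^{1/p}; together with |u i|
  -- ≤ ‖a‖ this bounds the sum of squares.
  let s : Fin n → ℝ := fun i => (SignType.sign (u i) : ℝ)
  have hs : ∀ i, |s i| ≤ 1 := fun i => by
    simp only [s]
    rcases SignType.sign (u i) with _ | _ | _ <;> simp
  have h2 : ∑ i, |u i| ≤ ‖a‖ * (n : ℝ) ^ (1 / p) := by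
    have h3 : ∑ i, |u i| = ρ (a (∑ i : Fin n, (s i : 𝕜) • unitVector 𝕜 p i) t) := by
      rw [map_sum, lp.coeFn_sum, Finset.sum_apply, map_sum]
      refine Finset.sum_congr rfl fun i _ => ?_
      rw [map_smul, lp.coeFn_smul, Pi.smul_apply, smul_eq_mul, ← RCLike.real_smul_eq_coe_mul,
        map_smul, smul_eq_mul]
      exact (sign_mul_self (u i)).symm
    rw [h3]
    refine (le_abs_self _).trans ((hρ _).trans ((linfty_apply_le _ t).trans
      ((a.le_opNorm _).trans ?_)))
    exact mul_le_mul_of_nonneg_left (norm_sum_smul_unitVector_le s hs) (norm_nonneg _)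
  calc ∑ i, u i ^ 2 ≤ ∑ i, ‖a‖ * |u i| := by
        refine Finset.sum_le_sum fun i _ => ?_
        rw [← sq_abs, sq]
        exact mul_le_mul_of_nonneg_right (h1 i) (abs_nonneg _)
    _ ≤ ‖a‖ * (‖a‖ * (n : ℝ) ^ (1 / p)) := by
        rw [← Finset.mul_sum]
        exact mul_le_mul_of_nonneg_left h2 (norm_nonneg _)
    _ = _ := by ring

/-- The trace of b ∘ a on n unit vectors is n, while `norm_trace_le` with l of order n^{1/(2p)}
bounds it by a multiple of n^{1/(2p)} n^{1-1/p}. -/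
theorem natCast_le_of_leftInverse (a : CountingSpace 𝕜 p →L[𝕜] lp (fun _ : ℕ => 𝕜) ∞)
    (b : lp (fun _ : ℕ => 𝕜) ∞ →L[𝕜] CountingSpace 𝕜 p) (hab : ∀ f, b (a f) = f) {n : ℕ}
    (hn : 0 < n) :
    (n : ℝ) ^ (1 / p / 2) ≤ 4 * (‖a‖ + 1) * ‖b‖ := by
  have hn0 : (0 : ℝ) < n := by exact_mod_cast hn
  -- The summand 1 keeps l positive.
  set l : ℝ := (‖a‖ + 1) * (n : ℝ) ^ (1 / p / 2) with hl
  have hl0 : 0 < l := by positivity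
  have hl2 : ‖a‖ ^ 2 * (n : ℝ) ^ (1 / p) ≤ l ^ 2 := by
    have h : ((n : ℝ) ^ (1 / p / 2)) ^ 2 = (n : ℝ) ^ (1 / p) := by
      rw [← Real.rpow_natCast, ← Real.rpow_mul hn0.le]
      congr 1
      push_cast
      ring
    rw [hl, mul_pow, h]
    refine mul_le_mul_of_nonneg_right ?_ (by positivity)
    exact pow_le_pow_left₀ (norm_nonneg _) (by linarith) 2
  let x : Fin n → lp (fun _ : ℕ => 𝕜) ∞ := fun i => a (unitVector 𝕜 p i)
  -- Riesz products need real functions, so real and imaginary parts are treated separately; this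
  -- doubles the constant.
  have key : ∀ (ρ : 𝕜 →ₗ[ℝ] ℝ) (hρ : ∀ z, |ρ z| ≤ ‖z‖),
      ‖∑ i, b (linftyMk (fun t => (ρ (x i t) : 𝕜)) ‖x i‖ fun t => by
        rw [RCLike.norm_ofReal]; exact (hρ _).trans (linfty_apply_le _ t)) i‖ ≤
        2 * l * ‖b‖ * (n : ℝ) ^ (1 - 1 / p) := fun ρ hρ =>
    norm_trace_le b _ (fun i t => ρ (x i t)) (fun i t => rfl) hl0
      fun t => (sum_sq_le a ρ hρ n t).trans hl2
  have hre := key RCLike.reLm RCLike.abs_re_le_norm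
  have him := key RCLike.imLm RCLike.abs_im_le_norm
  set R : Fin n → lp (fun _ : ℕ => 𝕜) ∞ := fun i =>
    linftyMk (fun t => (RCLike.reLm (x i t) : 𝕜)) ‖x i‖ fun t => by
      rw [RCLike.norm_ofReal]; exact (RCLike.abs_re_le_norm _).trans (linfty_apply_le _ t)
  set J : Fin n → lp (fun _ : ℕ => 𝕜) ∞ := fun i =>
    linftyMk (fun t => (RCLike.imLm (x i t) : 𝕜)) ‖x i‖ fun t => by
      rw [RCLike.norm_ofReal]; exact (RCLike.abs_im_le_norm _).trans (linfty_apply_le _ t)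
  have hx : ∀ i, x i = R i + (RCLike.I : 𝕜) • J i := by
    intro i
    ext t
    rw [lp.coeFn_add, Pi.add_apply, lp.coeFn_smul, Pi.smul_apply, smul_eq_mul, mul_comm]
    exact (RCLike.re_add_im (x i t)).symm
  have hone : ∀ i : Fin n, b (x i) i = (1 : 𝕜) := by
    intro i
    simp only [x, hab, unitVector_apply, if_true]
  have hsum : (n : 𝕜) = ∑ i, b (R i) i + RCLike.I * ∑ i, b (J i) i := by
    have h5 : (n : 𝕜) = ∑ i, b (x i) i := by
      rw [Finset.sum_congr rfl fun i _ => hone i]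
      simp
    rw [h5, Finset.mul_sum, ← Finset.sum_add_distrib]
    refine Finset.sum_congr rfl fun i _ => ?_
    rw [hx i, map_add, map_smul, MeanSpace.add_apply, MeanSpace.smul_apply]
  have hle : (n : ℝ) ≤ 4 * l * ‖b‖ * (n : ℝ) ^ (1 - 1 / p) := by
    have h6 : ‖(n : 𝕜)‖ = n := RCLike.norm_natCast n
    refine h6.symm.le.trans ?_
    rw [hsum]
    refine (norm_add_le _ _).trans ?_
    rw [norm_mul]
    have h7 : ‖(RCLike.I : 𝕜)‖ * ‖∑ i, b (J i) i‖ ≤ ‖∑ i, b (J i) i‖ :=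
      mul_le_of_le_one_left (norm_nonneg _) (by
        rw [RCLike.norm_I]; split_ifs <;> norm_num)
    exact (add_le_add_right h7 _).trans ((add_le_add hre him).trans_eq (by ring))
  have hpow : (n : ℝ) = (n : ℝ) ^ (1 / p / 2) * ((n : ℝ) ^ (1 / p / 2) * (n : ℝ) ^ (1 - 1 / p)) := by
    rw [← Real.rpow_add hn0, ← Real.rpow_add hn0]
    ring_nf
    simp
  refine le_of_mul_le_mul_right (a := (n : ℝ) ^ (1 / p / 2) * (n : ℝ) ^ (1 - 1 / p)) ?_
    (by positivity)
  rw [← hpow]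
  refine hle.trans (le_of_eq ?_)
  rw [hl]
  ring

/-- Weak `ℓ^p` is not isomorphic to `ℓ^∞`. -/
theorem not_nonempty_countingSpace_equiv_linfty :
    ¬ Nonempty (CountingSpace 𝕜 p ≃L[𝕜] lp (fun _ : ℕ => 𝕜) ∞) := by
  rintro ⟨e⟩
  have hq : 0 < 1 / p / 2 := half_pos one_div_mem_Ioo.1
  have h1 := ((tendsto_rpow_atTop hq).comp tendsto_natCast_atTop_atTop).eventually_gt_atTop
    (4 * (‖(e : CountingSpace 𝕜 p →L[𝕜] lp (fun _ : ℕ => 𝕜) ∞)‖ + 1) *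
      ‖(e.symm : lp (fun _ : ℕ => 𝕜) ∞ →L[𝕜] CountingSpace 𝕜 p)‖)
  obtain ⟨n, hn, hn0⟩ := (h1.and (Filter.eventually_gt_atTop 0)).exists
  exact absurd (natCast_le_of_leftInverse _ _ (fun f => e.symm_apply_apply f) hn0) (not_le.mpr hn)

end NotIsomorphic

/-! ### Bounded multiplicities -/

section BoundedMultiplicity

theorem sum_two_zpow_le (G : Finset ℤ) (K : ℤ) (h : ∀ n ∈ G, n ≤ K) :
    ∑ n ∈ G, (2 : ℝ) ^ n ≤ 2 * 2 ^ K := by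
  induction G using Finset.induction_on_max generalizing K with
  | empty => simp; positivity
  | insert a s ha ih =>
    have has : a ∉ s := fun hmem => lt_irrefl a (ha a hmem)
    rw [Finset.sum_insert has]
    have h1 := ih (a - 1) fun n hn => by have := ha n hn; omega
    have h2 : (2 : ℝ) * 2 ^ (a - 1) = 2 ^ a := by
      rw [zpow_sub_one₀ two_ne_zero]
      ring
    have h3 : (2 : ℝ) ^ a ≤ 2 ^ K :=
      zpow_le_zpow_right₀ one_le_two (h a (Finset.mem_insert_self _ _))
    linarith

variable {𝕜 : Type*} [RCLike 𝕜] {Γ : Type*} {w : Γ → ℝ}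

/-- If the weights are powers of two with bounded multiplicities, then the measure of a set is
controlled by its largest atom. -/
theorem sum_weight_le_of_encard_le (hw2 : ∀ γ, ∃ n : ℤ, w γ = (2 : ℝ) ^ n) {N : ℕ}
    (hN : ∀ n : ℤ, {γ : Γ | w γ = (2 : ℝ) ^ n}.encard ≤ N) {s : ℝ} (hs : 0 ≤ s) (A : Finset Γ)
    (hA : ∀ γ ∈ A, w γ ≤ s) : ∑ γ ∈ A, w γ ≤ 2 * N * s := by
  classical
  rcases A.eq_empty_or_nonempty with rfl | hne
  · rw [Finset.sum_empty]
    positivity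
  choose n hn using hw2
  obtain ⟨γ₀, hγ₀, hmax⟩ := A.exists_max_image n hne
  rw [← Finset.sum_fiberwise_of_maps_to (t := A.image n) fun γ hγ => Finset.mem_image_of_mem n hγ]
  have h1 : ∀ k ∈ A.image n, ∑ γ ∈ A with n γ = k, w γ ≤ N * 2 ^ k := by
    intro k _
    rw [Finset.sum_congr rfl fun γ hγ => by rw [hn, (Finset.mem_filter.mp hγ).2], Finset.sum_const,
      nsmul_eq_mul]
    refine mul_le_mul_of_nonneg_right ?_ (by positivity)
    have h2 : ((A.filter fun γ => n γ = k : Finset Γ) : Set Γ) ⊆ {γ | w γ = (2 : ℝ) ^ k} := by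
      intro γ hγ
      have : n γ = k := (Finset.mem_filter.mp hγ).2
      change w γ = 2 ^ k
      rw [hn, this]
    have h3 := (Set.encard_le_encard h2).trans (hN k)
    rw [Set.encard_coe_eq_coe_finsetCard] at h3
    exact_mod_cast h3
  calc _ ≤ ∑ k ∈ A.image n, (N : ℝ) * 2 ^ k := Finset.sum_le_sum h1
    _ ≤ N * (2 * 2 ^ n γ₀) := by
        rw [← Finset.mul_sum]
        refine mul_le_mul_of_nonneg_left (sum_two_zpow_le _ _ fun k hk => ?_) (Nat.cast_nonneg _)
        obtain ⟨γ, hγ, rfl⟩ := Finset.mem_image.mp hk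
        exact hmax γ hγ
    _ ≤ N * (2 * s) := by
        have := hA γ₀ hγ₀
        rw [hn] at this
        gcongr
    _ = _ := by ring

variable {p : ℝ} [hp : Fact (1 < p)] [hw : Fact (∀ γ, 0 < w γ)]

/-- At height c only atoms of weight at most (C/c)^p contribute, and bounded multiplicity bounds
their total by 2N(C/c)^p. -/
theorem isMeanBound_weight_rpow_mul {Δ : Type*} (hw2 : ∀ γ, ∃ n : ℤ, w γ = (2 : ℝ) ^ n) {N : ℕ}
    (hN1 : 1 ≤ N) (hN : ∀ n : ℤ, {γ : Γ | w γ = (2 : ℝ) ^ n}.encard ≤ N) (e : Γ → Δ) (g : Δ → 𝕜)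
    {C : ℝ} (hC : 0 ≤ C) (hg : ∀ δ, ‖g δ‖ ≤ C) :
    IsMeanBound p w (fun γ => ((w γ ^ (-(1 / p)) : ℝ) : 𝕜) * g (e γ))
      (kolmogorovConst p * (2 * N * C)) := by
  have hp0 : 0 < p := one_pos.trans hp.out
  refine isMeanBound_of_weak (by positivity) fun c hc A hA => ?_
  have hcp : 0 < c ^ p := by positivity
  have h1 : ∀ γ ∈ A, w γ ≤ C ^ p / c ^ p := by
    intro γ hγ
    have hwγ := hw.out γ
    have h2 := hA γ hγ
    rw [norm_mul, RCLike.norm_ofReal, abs_of_pos (by positivity), Real.rpow_neg hwγ.le,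
      inv_mul_eq_div, le_div_iff₀ (by positivity)] at h2
    have h3 := Real.rpow_le_rpow (by positivity) (h2.trans (hg _)) hp0.le
    rw [Real.mul_rpow hc.le (by positivity), ← Real.rpow_mul hwγ.le, one_div_mul_cancel hp0.ne',
      Real.rpow_one] at h3
    rw [le_div_iff₀ hcp]
    linarith
  have hN1' : (1 : ℝ) ≤ N := by exact_mod_cast hN1
  calc c ^ p * ∑ γ ∈ A, w γ ≤ c ^ p * (2 * N * (C ^ p / c ^ p)) :=
        mul_le_mul_of_nonneg_left (sum_weight_le_of_encard_le hw2 hN (by positivity) A h1) hcp.le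
    _ = 2 * N * C ^ p := by field_simp
    _ ≤ (2 * N) ^ p * C ^ p :=
        mul_le_mul_of_nonneg_right
          (Real.self_le_rpow_of_one_le (by linarith) hp.out.le) (by positivity)
    _ = (2 * N * C) ^ p := (Real.mul_rpow (by positivity) hC).symm

theorem nonempty_equiv_linfty [Countable Γ] [Infinite Γ]
    (hw2 : ∀ γ, ∃ n : ℤ, w γ = (2 : ℝ) ^ n)
    (h : (⨆ n : ℤ, {γ : Γ | w γ = (2 : ℝ) ^ n}.encard) < ⊤) :
    Nonempty (MeanSpace 𝕜 p w ≃L[𝕜] lp (fun _ : ℕ => 𝕜) ∞) := by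
  obtain ⟨N, hN⟩ := ENat.ne_top_iff_exists.mp h.ne
  -- `N + 1` ensures a bound of at least 1, needed for 2N ≤ (2N)^p.
  have hN' : ∀ n : ℤ, {γ : Γ | w γ = (2 : ℝ) ^ n}.encard ≤ ((N + 1 : ℕ) : ℕ∞) := fun n =>
    (le_iSup (fun n : ℤ => {γ : Γ | w γ = (2 : ℝ) ^ n}.encard) n).trans
      (hN.symm.le.trans (by exact_mod_cast Nat.le_succ N))
  obtain ⟨_⟩ := nonempty_denumerable Γ
  let e : Γ ≃ ℕ := Denumerable.eqv Γ
  have hb : ∀ (f : MeanSpace 𝕜 p w) t,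
      ‖((w (e.symm t) ^ (1 / p) : ℝ) : 𝕜) * f (e.symm t)‖ ≤ ‖f‖ := by
    intro f t
    have hwt := hw.out (e.symm t)
    have h1 := f.apply_le (e.symm t)
    rw [norm_mul, RCLike.norm_ofReal, abs_of_pos (by positivity)]
    rw [Real.rpow_neg hwt.le, ← div_eq_mul_inv, le_div_iff₀ (by positivity)] at h1
    linarith
  let F : MeanSpace 𝕜 p w →L[𝕜] lp (fun _ : ℕ => 𝕜) ∞ :=
    LinearMap.mkContinuous
      { toFun := fun f => linftyMk _ _ (hb f)
        map_add' := fun f g => by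
          ext t
          simp [mul_add]
        map_smul' := fun c f => by
          ext t
          simp [mul_left_comm] } 1
      fun f => by
        rw [one_mul]
        exact norm_linftyMk_le (norm_nonneg _) (hb f)
  let G : lp (fun _ : ℕ => 𝕜) ∞ →L[𝕜] MeanSpace 𝕜 p w :=
    MeanSpace.lift
      { toFun := fun g γ => ((w γ ^ (-(1 / p)) : ℝ) : 𝕜) * g (e γ)
        map_add' := fun f g => by
          ext γ
          simp [mul_add]
        map_smul' := fun c f => by
          ext γ
          simp [mul_left_comm] } (kolmogorovConst p * (2 * ((N + 1 : ℕ) : ℝ)))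
      fun g => by
        have := isMeanBound_weight_rpow_mul (p := p) hw2 (Nat.le_add_left 1 N) hN' e g (norm_nonneg g)
          (linfty_apply_le g)
        rw [mul_assoc]
        exact this
  refine ⟨ContinuousLinearEquiv.equivOfInverse F G (fun f => ?_) fun g => ?_⟩
  · ext γ
    have hwγ := hw.out γ
    change ((w γ ^ (-(1 / p)) : ℝ) : 𝕜) *
      (((w (e.symm (e γ)) ^ (1 / p) : ℝ) : 𝕜) * f (e.symm (e γ))) = f γ
    rw [e.symm_apply_apply, ← mul_assoc, ← RCLike.ofReal_mul, ← Real.rpow_add hwγ]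
    simp
  · ext t
    have hwt := hw.out (e.symm t)
    change ((w (e.symm t) ^ (1 / p) : ℝ) : 𝕜) *
      (((w (e.symm t) ^ (-(1 / p)) : ℝ) : 𝕜) * g (e (e.symm t))) = g t
    rw [e.apply_symm_apply, ← mul_assoc, ← RCLike.ofReal_mul, ← Real.rpow_add hwt]
    simp

end BoundedMultiplicity

end

/-! ### The dichotomy -/

theorem mainTheorem1 (𝕜 : Type*) [RCLike 𝕜] (p : ℝ) [Fact (1 < p)]
    (Γ : Type*) [Countable Γ] [Infinite Γ]
    (w : Γ → ℝ) (hw : ∀ γ, ∃ n : ℤ, w γ = (2 : ℝ) ^ n) :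
    (Nonempty (WeakLp 𝕜 p w ≃L[𝕜] WeakLp 𝕜 p (fun _ : ℕ => (1 : ℝ))) ↔
        (⨆ n : ℤ, {γ : Γ | w γ = (2 : ℝ) ^ n}.encard) = ⊤) ∧
      (Nonempty (WeakLp 𝕜 p w ≃L[𝕜] lp (fun _ : ℕ => 𝕜) ∞) ↔
        (⨆ n : ℤ, {γ : Γ | w γ = (2 : ℝ) ^ n}.encard) < ⊤) := by
  have hpos : Fact (∀ γ, 0 < w γ) := ⟨fun γ => by
    obtain ⟨n, hn⟩ := hw γ
    rw [hn]
    positivity⟩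
  let E : WeakLp 𝕜 p w ≃L[𝕜] MeanSpace 𝕜 p w := weakLpEquivMeanSpace
  let E₁ : WeakLp 𝕜 p (fun _ : ℕ => (1 : ℝ)) ≃L[𝕜] CountingSpace 𝕜 p := weakLpEquivMeanSpace
  have htop : (⨆ n : ℤ, {γ : Γ | w γ = (2 : ℝ) ^ n}.encard) = ⊤ →
      Nonempty (WeakLp 𝕜 p w ≃L[𝕜] WeakLp 𝕜 p (fun _ : ℕ => (1 : ℝ))) := fun h => by
    obtain ⟨a⟩ := nonempty_equiv_countingSpace (𝕜 := 𝕜) (p := p) hw h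
    exact ⟨(E.trans a).trans E₁.symm⟩
  have hlt : (⨆ n : ℤ, {γ : Γ | w γ = (2 : ℝ) ^ n}.encard) < ⊤ →
      Nonempty (WeakLp 𝕜 p w ≃L[𝕜] lp (fun _ : ℕ => 𝕜) ∞) := fun h => by
    obtain ⟨a⟩ := nonempty_equiv_linfty (𝕜 := 𝕜) (p := p) hw h
    exact ⟨E.trans a⟩
  -- Since the two conditions on the multiplicities are complementary, this incompatibility turns
  -- both implications above into equivalences.
  have hnot : Nonempty (WeakLp 𝕜 p w ≃L[𝕜] WeakLp 𝕜 p (fun _ : ℕ => (1 : ℝ))) →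
      ¬ Nonempty (WeakLp 𝕜 p w ≃L[𝕜] lp (fun _ : ℕ => 𝕜) ∞) := by
    rintro ⟨a⟩ ⟨b⟩
    exact not_nonempty_countingSpace_equiv_linfty ⟨(E₁.symm.trans a.symm).trans b⟩
  refine ⟨⟨fun h => ?_, htop⟩, ⟨fun h => ?_, hlt⟩⟩
  · by_contra hne
    exact hnot h (hlt (lt_top_iff_ne_top.mpr hne))
  · refine lt_top_iff_ne_top.mpr fun heq => ?_
    exact hnot (htop heq) h
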